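/- Let $p\neq q$ be odd primes, let $P$ be a finite $p$-group, let $Q$ be a finite $q$-group acting on $P$ by automorphisms, and identify $P$ and $Q$ with their images in the semidirect product $Q\ltimes P$. (1) Let $\mathcal T$ be a finite-dimensional $\mathbb F_q[Q\ltimes P]$-module on which $P$ acts faithfully. Then there is a vector $\tau\in\mathcal T$ whose stabilizer $\{g\in Q\ltimes P : g\tau=\tau\}$ is exactly $Q$. Suppose that $Q\ltimes P$ acts by automorphisms on a finite $q$-group $S$ and that $P$ acts faithfully on $S$. A linear character of $S$ is a homomorphism $\lambda:S\to\mathbb C^\times$; its stabilizer in $Q\ltimes P$ is the subgroup of all $g$ with $\lambda(g\cdot s)=\lambda(s)$ for every $s\in S$. Then: (2) there is a linear character $\lambda$ of $S$ whose kernel contains the Frattini subgroup $\Phi(S)$ and whose stabilizer in $Q\ltimes P$ is exactly $Q$; (3) there is a linear character $\lambda$ of $S$ whose kernel contains $C_S(P)=\{s\in S : x\cdot s=s \text{ for all } x\in P\}$ and whose stabilizer in $Q\ltimes P$ is exactly $Q$. -/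

import Mathlib

namespace CoprimeAction

/-- The stabilizer `G(τ) = {g | g τ = τ}` of a vector `τ` of a `k[G]`-module. -/
def vectorStabilizer {k G T : Type*} [CommRing k] [Group G] [AddCommGroup T] [Module k T]
    (ρ : Representation k G T) (τ : T) : Subgroup G where
  carrier := {g | ρ g τ = τ}
  one_mem' := by simp
  mul_mem' := by
    intro a b ha hb
    simp only [Set.mem_setOf_eq] at ha hb ⊢
    rw [map_mul, Module.End.mul_apply, hb, ha]
  inv_mem' := by
    intro a ha
    simp only [Set.mem_setOf_eq] at ha ⊢
    conv_lhs => rw [← ha]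
    rw [← Module.End.mul_apply, ← map_mul, inv_mul_cancel, map_one, Module.End.one_apply]

/-- The stabilizer in `G` of a linear character `χ : S → ℂˣ`, where `G` acts on the group `S` by
automorphisms: those `g` for which the conjugate character of `χ` by `g` is `χ` again. -/
def linCharStabilizer {G S : Type*} [Group G] [Group S] (α : G →* MulAut S) (χ : S →* ℂˣ) :
    Subgroup G where
  carrier := {g | ∀ s : S, χ (α g s) = χ s}
  one_mem' := by simp
  mul_mem' := by
    intro a b ha hb s
    rw [map_mul, MulAut.mul_apply, ha, hb]
  inv_mem' := by
    intro a ha s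
    rw [← ha (α a⁻¹ s), ← MulAut.mul_apply, ← map_mul, mul_inv_cancel, map_one, MulAut.one_apply]

/-- The subgroup `C_S(H)` of the elements of `S` that are fixed by every element of `H`, where
`H` acts on the group `S` by automorphisms. -/
def actionCentralizer {H S : Type*} [Group H] [Group S] (α : H →* MulAut S) : Subgroup S where
  carrier := {s | ∀ h : H, α h s = s}
  one_mem' := by simp
  mul_mem' := by
    intro a b ha hb h
    rw [map_mul, ha, hb]
  inv_mem' := by
    intro a ha h
    rw [map_inv, ha]

end CoprimeAction

namespace CoprimeAction

open Subgroup
open scoped commutatorElement IsMulCommutative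

/-! ### Commutators and powers in `p`-groups -/

/-! All three statements reduce to `exists_regular_fixed_vector`: if a `q`-group `Q` normalizes a
`p`-group `P` of automorphisms of a finite elementary abelian `q`-group `T`, some `τ` fixed by `Q`
has trivial stabilizer in `P`. Since `Q` fixes `τ`, an element `x * y` with `x` in `P` and `y` in
`Q` fixes `τ` only if `x` does, so the full stabilizer is `Q`.

The induction is on the order of `T`, then on that of `P`. Call an idempotent of `End T` orthogonal
if its distinct conjugates under `P ⊔ Q` are orthogonal to it; its images then behave like blocks of
imprimitivity.

If only `0` and `1` are orthogonal, every abelian normal subgroup of `P` normalized by `Q` acts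
semiregularly on `T` (`eq_one_of_smul_eq_of_primitive`), so it has at most one subgroup of order `p`
and meets the stabilizer of a nonzero vector trivially. For odd `p`, this forces the stabilizer in
`P` of any nonzero `Q`-fixed vector to be trivial (`eq_one_of_mem_of_abelian_normal`).

Otherwise a proper block exists. If `P` preserves it, regular vectors of smaller modules are glued
together (`exists_regular_of_commute`). If the blocks moved by `P` fill `T`, a regular vector for a
maximal `Q`-invariant subgroup of `P` is adjusted by a sign on one block
(`exists_regular_of_maximal`); this is where `q` odd enters.

For `S`, take `T` to be the group of characters of `S` with values in the `q`-th roots of unity. It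
is faithful for `P` by coprimality (`eq_one_of_fixes_characters`), and these characters kill the
Frattini subgroup. Subtracting from `τ` its average over `P` kills `C_S(P)` and keeps the
stabilizer. -/

theorem exists_mem_notMem_commutator_mem {R : Type*} [Group R] [Group.IsNilpotent R]
    {Z F : Subgroup R} (hF : F.Normal) (h : ¬ F ≤ Z) :
    ∃ x ∈ F, x ∉ Z ∧ ∀ g, ⁅x, g⁆ ∈ Z := by
  classical
  -- At the first term of the upper central series whose intersection with `F` leaves `Z`,
  -- commutators drop into the preceding term, hence into `Z`.
  have hex : ∃ n, ¬ F ⊓ Subgroup.upperCentralSeries R n ≤ Z := by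
    obtain ⟨n, hn⟩ := Group.IsNilpotent.nilpotent R
    exact ⟨n, by simpa [hn] using h⟩
  have hspec := Nat.find_spec hex
  have hmin := fun m => Nat.find_min hex (m := m)
  generalize Nat.find hex = n at hspec hmin
  cases n with
  | zero =>
    exact absurd (by simp) hspec
  | succ n =>
    obtain ⟨x, ⟨hxF, hxu⟩, hxZ⟩ := SetLike.not_le_iff_exists.1 hspec
    refine ⟨x, hxF, hxZ, fun g => ?_⟩
    have h1 := not_not.1 (hmin n (Nat.lt_succ_self n))
    refine h1 ⟨?_, Subgroup.mem_upperCentralSeries_succ_iff.1 hxu g⟩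
    have : ⁅x, g⁆ = x * (g * x⁻¹ * g⁻¹) := by rw [commutatorElement_def]; group
    rw [this]
    exact F.mul_mem hxF (hF.conj_mem _ (F.inv_mem hxF) g)

theorem commutator_mul_left_of_central {R : Type*} [Group R] {a b g : R}
    (h : ∀ y, Commute ⁅b, g⁆ y) : ⁅a * b, g⁆ = ⁅a, g⁆ * ⁅b, g⁆ :=
  calc ⁅a * b, g⁆ = a * ⁅b, g⁆ * g * a⁻¹ * g⁻¹ := by simp only [commutatorElement_def]; group
    _ = ⁅b, g⁆ * ⁅a, g⁆ := by rw [← (h a).eq]; simp only [commutatorElement_def]; group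
    _ = ⁅a, g⁆ * ⁅b, g⁆ := (h _).eq

/-- Moving `x` to the left past `y ^ i` costs `c ^ i`, and the exponents `0 + 1 + ... + (n - 1)` add
up to the binomial coefficient. -/
theorem mul_pow_of_central_commutator {R : Type*} [Group R] {x y c : R} (h : y * x = x * y * c)
    (hx : Commute c x) (hy : Commute c y) (n : ℕ) :
    (x * y) ^ n = x ^ n * y ^ n * c ^ n.choose 2 := by
  have key : ∀ n : ℕ, y ^ n * x = x * y ^ n * c ^ n := by
    intro n
    induction n with
    | zero => simp
    | succ n ih =>
      rw [pow_succ, mul_assoc, h, ← mul_assoc, ← mul_assoc, ih, mul_assoc (x * y ^ n),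
        (hy.pow_left n).eq, pow_succ c]
      simp only [mul_assoc]
  induction n with
  | zero => simp
  | succ n ih =>
    rw [pow_succ, ih, Nat.choose_succ_succ' n 1, Nat.choose_one_right, pow_add c,
      pow_succ x n, pow_succ y n]
    calc x ^ n * y ^ n * c ^ n.choose 2 * (x * y)
        = x ^ n * y ^ n * (c ^ n.choose 2 * (x * y)) := by simp only [mul_assoc]
      _ = x ^ n * y ^ n * (x * y * c ^ n.choose 2) := by
          rw [((hx.mul_right hy).pow_left _).eq]
      _ = x ^ n * (y ^ n * x) * y * c ^ n.choose 2 := by simp only [mul_assoc]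
      _ = x ^ n * x * y ^ n * (c ^ n * y) * c ^ n.choose 2 := by rw [key]; simp only [mul_assoc]
      _ = x ^ n * x * (y ^ n * y) * (c ^ n * c ^ n.choose 2) := by
          rw [(hy.pow_left n).eq]; simp only [mul_assoc]

/-- For odd `p` the exponent `p.choose 2` is a multiple of `p`, so the correction term disappears.
-/
theorem mul_pow_prime_of_central_commutator {R : Type*} [Group R] {p : ℕ} (hp : p.Prime)
    (hodd : Odd p) {x y : R} (hc : ∀ g, Commute ⁅y, x⁆ g) (hcp : ⁅y, x⁆ ^ p = 1) :
    (x * y) ^ p = x ^ p * y ^ p := by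
  have h : y * x = x * y * ⁅y, x⁆ := by
    rw [← (hc (x * y)).eq, commutatorElement_def]; group
  rw [mul_pow_of_central_commutator h (hc x) (hc y)]
  have : p ∣ p.choose 2 := hp.dvd_choose_self (by norm_num)
    (lt_of_le_of_ne hp.two_le (by rintro rfl; exact absurd hodd (by decide)))
  obtain ⟨k, hk⟩ := this
  rw [hk, pow_mul, hcp, one_pow, mul_one]

/-- By Fermat `m` is `1` modulo `p`, so lifting the exponent shows that `m ^ p - 1` has exactly one
more factor `p` than `m - 1`. -/
theorem pow_dvd_prime_mul_sub_one {p : ℕ} [Fact p.Prime] (hodd : Odd p) {m : ℤ} {k : ℕ}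
    (h : (p : ℤ) ^ k ∣ m ^ p - 1) : (p : ℤ) ^ k ∣ p * (m - 1) := by
  have hp : p.Prime := Fact.out
  rcases Nat.eq_zero_or_pos k with rfl | hk
  · simp
  have h1 : (p : ℤ) ∣ m ^ p - 1 := (dvd_pow_self _ hk.ne').trans h
  have h2 : (p : ℤ) ∣ m - 1 := by
    rw [← ZMod.intCast_zmod_eq_zero_iff_dvd] at h1 ⊢
    push_cast at h1 ⊢
    rwa [ZMod.pow_card] at h1
  have hpZ : Prime (p : ℤ) := Nat.prime_iff_prime_int.1 hp
  have h3 : ¬ (p : ℤ) ∣ m := by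
    intro h3
    have : (p : ℤ) ∣ 1 := by simpa using dvd_sub h3 h2
    exact hpZ.not_dvd_one this
  rw [pow_dvd_iff_le_emultiplicity] at h ⊢
  have := Int.emultiplicity_pow_sub_pow hp hodd h2 h3 p
  rw [one_pow] at this
  rw [this] at h
  rw [emultiplicity_mul hpZ, add_comm, Int.natCast_emultiplicity]
  exact h

/-! ### Structure of `p`-groups for odd `p` -/

/-- If `p` is odd, a finite `p`-group in which every normal subgroup of exponent `p` is contained in
a fixed central cyclic subgroup `Z` of exponent `p` has all its elements of order `p` in `Z`. -/
theorem mem_of_pow_prime_eq_one {p : ℕ} [Fact p.Prime] (hodd : Odd p) {R : Type*} [Group R]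
    [Finite R] (hR : IsPGroup p R) {Z : Subgroup R} (hZc : ∀ z ∈ Z, ∀ g, Commute z g)
    (hZcyc : ∃ z, zpowers z = Z) (hZp : ∀ z ∈ Z, z ^ p = 1)
    (h : ∀ x : R, x ^ p = 1 → (∀ g, ⁅x, g⁆ ∈ Z) → x ∈ Z) (x : R) (hx : x ^ p = 1) : x ∈ Z := by
  have hp : p.Prime := Fact.out
  have := hR.isNilpotent
  have hN : ∀ F : Subgroup R, F.Normal → (∀ x ∈ F, x ^ p = 1) → F ≤ Z := by
    intro F hF hFp
    by_contra hcon
    obtain ⟨x, hxF, hxZ, hg⟩ := exists_mem_notMem_commutator_mem hF hcon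
    exact hxZ (h x (hFp x hxF) hg)
  have hZn : Z.Normal := ⟨fun z hz g => by
    rw [← (hZc z hz g).eq, mul_inv_cancel_right]; exact hz⟩
  -- `A` is maximal among the cyclic normal subgroups containing `Z`; the aim is to show that it is
  -- the whole group.
  obtain ⟨A, hZA, hA⟩ := (Set.toFinite {A : Subgroup R | A.Normal ∧ ∃ a, zpowers a = A}).exists_le_maximal
    (a := Z) ⟨hZn, hZcyc⟩
  obtain ⟨⟨hAn, a, ha⟩, hAmax⟩ := hA
  have haA : a ∈ A := by rw [← ha]; exact mem_zpowers a
  have hAcomm : ∀ x ∈ A, ∀ y ∈ A, Commute x y := by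
    intro x hx y hy
    rw [← ha] at hx hy
    obtain ⟨i, rfl⟩ := hx
    obtain ⟨j, rfl⟩ := hy
    exact (Commute.refl a).zpow_zpow i j
  by_cases hAtop : A = ⊤
  · refine h x hx fun g => ?_
    have : Commute x g := hAcomm x (hAtop ▸ mem_top x) g (hAtop ▸ mem_top g)
    rw [commutatorElement_eq_one_iff_commute.2 this]
    exact Z.one_mem
  exfalso
  -- elements of order `p` in `A` lie in `Z`
  have hAΩ : ∀ x ∈ A, x ^ p = 1 → x ∈ Z := by
    let Ω : Subgroup R :=
      { carrier := {x | x ∈ A ∧ x ^ p = 1}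
        one_mem' := ⟨A.one_mem, one_pow _⟩
        mul_mem' := fun {x y} hx hy => ⟨A.mul_mem hx.1 hy.1, by
          rw [(hAcomm x hx.1 y hy.1).mul_pow, hx.2, hy.2, one_mul]⟩
        inv_mem' := fun {x} hx => ⟨A.inv_mem hx.1, by rw [inv_pow, hx.2, inv_one]⟩ }
    have := hN Ω ⟨fun x hx g => ⟨hAn.conj_mem x hx.1 g, by rw [conj_pow, hx.2]; simp⟩⟩
      (fun x hx => hx.2)
    exact fun x hx hxp => this ⟨hx, hxp⟩
  -- `b` is central of order `p` modulo `A`: the last `p`-power of a central coset representative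
  -- before it falls into `A`.
  obtain ⟨b, hbA, hbR, hbp⟩ : ∃ b, b ∉ A ∧ (∀ g, ⁅b, g⁆ ∈ A) ∧ b ^ p ∈ A := by
    obtain ⟨b, -, hbA, hbR⟩ := exists_mem_notMem_commutator_mem (Z := A) (F := ⊤) inferInstance
      (by rwa [top_le_iff])
    have hex : ∃ n, b ^ p ^ n ∈ A := by
      obtain ⟨n, hn⟩ := hR b
      exact ⟨n, by rw [hn]; exact A.one_mem⟩
    classical
    have hspec := Nat.find_spec hex
    have hmin := fun m => Nat.find_min hex (m := m)
    generalize Nat.find hex = n at hspec hmin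
    cases n with
    | zero => exact absurd (by simpa using hspec) hbA
    | succ n =>
      refine ⟨b ^ p ^ n, hmin n (Nat.lt_succ_self n), fun g => ?_, by rwa [← pow_mul, ← pow_succ]⟩
      have hq : ∀ y : R, ⁅y, g⁆ ∈ A ↔ Commute (y : R ⧸ A) (g : R ⧸ A) := fun y => by
        rw [← commutatorElement_eq_one_iff_commute, ← QuotientGroup.eq_one_iff]
        rfl
      rw [hq]
      exact ((hq b).1 (hbR g)).pow_left _
  -- `b` centralizes `A` modulo `Z`
  have hab : ⁅a, b⁆ ∈ Z := by
    have hconj : b * a * b⁻¹ ∈ zpowers a := by rw [ha]; exact hAn.conj_mem a haA b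
    obtain ⟨m, hm⟩ := hconj
    simp only at hm
    have hpow : ∀ n : ℕ, b ^ n * a * (b ^ n)⁻¹ = a ^ (m ^ n) := by
      intro n
      induction n with
      | zero => simp
      | succ n ih =>
        calc b ^ (n + 1) * a * (b ^ (n + 1))⁻¹ = b * (b ^ n * a * (b ^ n)⁻¹) * b⁻¹ := by
              rw [pow_succ']; group
          _ = a ^ (m ^ (n + 1)) := by
              rw [ih, ← conj_zpow, ← hm, ← zpow_mul, pow_succ']
    -- Conjugation by `b` raises `a` to the power `m`, and `b ^ p` lies in the abelian group `A`, so
    -- it acts trivially. Hence `⁅a, b⁆` is killed by `p`.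
    have h1 : a ^ (m ^ p - 1) = 1 := by
      have := hpow p
      rw [(hAcomm _ hbp a haA).eq, mul_inv_cancel_right] at this
      rw [zpow_sub, ← this]; simp
    obtain ⟨k, hk⟩ := (IsPGroup.iff_orderOf.1 hR) a
    have h2 : a ^ ((p : ℤ) * (m - 1)) = 1 := by
      rw [← orderOf_dvd_iff_zpow_eq_one, hk] at h1 ⊢
      push_cast at h1 ⊢
      exact pow_dvd_prime_mul_sub_one hodd h1
    have h3 : ⁅a, b⁆ = (a ^ (m - 1))⁻¹ := by
      rw [zpow_sub, hm, commutatorElement_def]; group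
    rw [h3]
    refine Z.inv_mem (hAΩ _ (A.zpow_mem haA _) ?_)
    rw [← zpow_natCast, ← zpow_mul, mul_comm]
    exact h2
  set B : Subgroup R := A ⊔ zpowers b with hB
  have haB : a ∈ B := (le_sup_left : A ≤ B) haA
  have hbB : b ∈ B := (le_sup_right : zpowers b ≤ B) (mem_zpowers b)
  have hBn : B.Normal := by
    refine ⟨fun x hx g => ?_⟩
    have hle : B ≤ B.comap (MulAut.conj g).toMonoidHom := by
      rw [hB, sup_le_iff, ← hB, zpowers_le]
      refine ⟨fun y hy => (le_sup_left : A ≤ B) (hAn.conj_mem y hy g), ?_⟩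
      change g * b * g⁻¹ ∈ B
      have : g * b * g⁻¹ = ⁅b, g⁆⁻¹ * b := by rw [commutatorElement_def]; group
      rw [this]
      exact B.mul_mem ((le_sup_left : A ≤ B) (A.inv_mem (hbR g))) hbB
    exact hle hx
  have hBcomm : ∀ x ∈ B, ∀ y ∈ B, ⁅x, y⁆ ∈ Z := by
    have hq : ∀ x y : R, ⁅x, y⁆ ∈ Z ↔ Commute (x : R ⧸ Z) (y : R ⧸ Z) := fun x y => by
      rw [← commutatorElement_eq_one_iff_commute, ← QuotientGroup.eq_one_iff]
      rfl
    have hle : ∀ y : R ⧸ Z, Commute (a : R ⧸ Z) y → Commute (b : R ⧸ Z) y →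
        ∀ x ∈ B, Commute (x : R ⧸ Z) y := by
      intro y h1 h2 x hx
      have : B ≤ (centralizer {y}).comap (QuotientGroup.mk' Z) := by
        rw [hB, ← ha, sup_le_iff, zpowers_le, zpowers_le]
        simp only [mem_comap, mem_centralizer_singleton_iff]
        exact ⟨h1.eq, h2.eq⟩
      have := this hx
      simp only [mem_comap, mem_centralizer_singleton_iff] at this
      exact this
    intro x hx y hy
    have hab' := (hq a b).1 hab
    rw [hq]
    refine hle _ (hle _ (Commute.refl _) hab'.symm y hy).symm
      (hle _ hab' (Commute.refl _) y hy).symm x hx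
  have hBpow : ∀ x ∈ B, ∀ y ∈ B, (x * y) ^ p = x ^ p * y ^ p := fun x hx y hy =>
    mul_pow_prime_of_central_commutator hp hodd (hZc _ (hBcomm y hy x hx)) (hZp _ (hBcomm y hy x hx))
  obtain ⟨j, hj⟩ : b ^ p ∈ zpowers a := by rw [ha]; exact hbp
  simp only at hj
  -- If `b ^ p` is a `p`-th power in `A`, correcting `b` by `A` gives an element killed by `p`
  -- outside `A`; but the elements of `B` killed by `p` form a normal subgroup, so they lie in `Z ≤
  -- A`. Otherwise `b ^ p` generates `A`, and `B = zpowers b` contradicts maximality.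
  by_cases hpj : (p : ℤ) ∣ j
  · obtain ⟨i, rfl⟩ := hpj
    have hpow : (a ^ (-i) * b) ^ p = 1 := by
      rw [hBpow _ (B.zpow_mem haB _) _ hbB, ← hj, ← zpow_natCast, ← zpow_mul, ← zpow_add]
      convert zpow_zero a using 2
      ring
    let Ω : Subgroup R :=
      { carrier := {x | x ∈ B ∧ x ^ p = 1}
        one_mem' := ⟨B.one_mem, one_pow _⟩
        mul_mem' := fun {x y} hx hy => ⟨B.mul_mem hx.1 hy.1, by
          rw [hBpow x hx.1 y hy.1, hx.2, hy.2, one_mul]⟩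
        inv_mem' := fun {x} hx => ⟨B.inv_mem hx.1, by rw [inv_pow, hx.2, inv_one]⟩ }
    have hΩ := hN Ω ⟨fun x hx g => ⟨hBn.conj_mem x hx.1 g, by rw [conj_pow, hx.2]; simp⟩⟩
      (fun x hx => hx.2)
    have h1 : a ^ (-i) * b ∈ A := hZA (hΩ ⟨B.mul_mem (B.zpow_mem haB _) hbB, hpow⟩)
    exact hbA ((A.mul_mem_cancel_left (A.zpow_mem haA _)).1 h1)
  · have hle : A ≤ zpowers b := by
      obtain ⟨k, hk⟩ := (IsPGroup.iff_orderOf.1 hR) a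
      have hcop : IsCoprime j ((p : ℤ) ^ k) :=
        (((Nat.prime_iff_prime_int.1 hp).coprime_iff_not_dvd.2 hpj).symm).pow_right
      obtain ⟨u, v, huv⟩ := hcop
      rw [← ha, zpowers_le]
      refine ⟨p * u, ?_⟩
      simp only
      have ho : a ^ ((p : ℤ) ^ k) = 1 := by
        rw [← orderOf_dvd_iff_zpow_eq_one, hk]; push_cast; exact dvd_rfl
      rw [zpow_mul, zpow_natCast, ← hj, ← zpow_mul]
      calc a ^ (j * u) = a ^ (1 - p ^ k * v) := by congr 1; linarith
        _ = a := by rw [zpow_sub, zpow_mul, ho]; simp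
    have hBb : B = zpowers b := by rw [hB, sup_eq_right]; exact hle
    exact hbA (hAmax ⟨hBn, b, hBb.symm⟩ le_sup_left hbB)

/-- In a finite group `E` whose centre contains all commutators and is of prime order, every
homomorphism to the centre that is trivial on the centre is given by commutators with an element. -/
theorem exists_commutator_eq {E : Type*} [Group E] [Finite E] {p : ℕ} [Fact p.Prime]
    (hcard : Nat.card (center E) = p) (hcomm : ∀ x y : E, ⁅x, y⁆ ∈ center E) (f : E →* center E)
    (hf : ∀ z ∈ center E, f z = 1) : ∃ y, ∀ x, (f x : E) = ⁅x, y⁆ := by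
  let _ : CommGroup (E ⧸ center E) :=
    { (inferInstance : Group (E ⧸ center E)) with
      mul_comm := by
        intro x y
        induction x using QuotientGroup.induction_on with | H x => ?_
        induction y using QuotientGroup.induction_on with | H y => ?_
        change Commute (x : E ⧸ center E) (y : E ⧸ center E)
        rw [← commutatorElement_eq_one_iff_commute]
        exact (QuotientGroup.eq_one_iff ⁅x, y⁆).2 (hcomm x y) }
  have : Nontrivial (center E) := by
    rw [← Finite.one_lt_card_iff_nontrivial, hcard]; exact (Fact.out : p.Prime).one_lt
  obtain ⟨z, hz⟩ := exists_ne (1 : center E)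
  -- A nontrivial character of a group of prime order is faithful, so `j` turns central commutators
  -- into complex numbers without loss.
  obtain ⟨j, hj⟩ := CommGroup.exists_apply_ne_one_of_hasEnoughRootsOfUnity (center E) ℂ hz
  have hjinj : Function.Injective j := by
    rw [← MonoidHom.ker_eq_bot_iff]
    have : Fact (Nat.card (center E)).Prime := by rw [hcard]; infer_instance
    refine j.ker.eq_bot_or_eq_top_of_prime_card.resolve_right fun htop => hj ?_
    exact (MonoidHom.mem_ker).1 (htop ▸ mem_top z)
  -- commutation with `y`, as a homomorphism
  let c : E → (E →* center E) := fun y =>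
    { toFun := fun x => ⟨⁅x, y⁆, hcomm x y⟩
      map_one' := by simp
      map_mul' := fun a b =>
        Subtype.ext <| commutator_mul_left_of_central fun g =>
          (mem_center_iff.1 (hcomm b y) g).symm }
  have hc : ∀ y, center E ≤ (j.comp (c y)).ker := by
    intro y z hz
    rw [MonoidHom.mem_ker, MonoidHom.comp_apply]
    have : c y z = 1 := by
      ext
      exact commutatorElement_eq_one_iff_commute.2 (mem_center_iff.1 hz y).symm
    rw [this, map_one]
  let d : E → ((E ⧸ center E) →* ℂˣ) := fun y => QuotientGroup.lift (center E) (j.comp (c y)) (hc y)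
  have hd : ∀ y y', d y = d y' → (y : E ⧸ center E) = y' := by
    intro y y' hyy
    have h1 : ∀ x : E, ⁅x, y⁆ = ⁅x, y'⁆ := by
      intro x
      have := DFunLike.congr_fun hyy (x : E ⧸ center E)
      have := hjinj (this : j (c y x) = j (c y' x))
      exact congrArg Subtype.val this
    rw [QuotientGroup.eq, mem_center_iff]
    intro x
    have h2 := h1 x
    simp only [commutatorElement_def, mul_assoc] at h2
    have h3 : y * (x⁻¹ * y⁻¹) = y' * (x⁻¹ * y'⁻¹) := mul_left_cancel h2
    have h4 : y'⁻¹ * (y * (x⁻¹ * y⁻¹)) * y = y'⁻¹ * (y' * (x⁻¹ * y'⁻¹)) * y := by rw [h3]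
    have h5 : y'⁻¹ * y * x⁻¹ = x⁻¹ * (y'⁻¹ * y) := by
      simpa [mul_assoc] using h4
    have h6 : Commute (y'⁻¹ * y) x := by
      have : Commute (y'⁻¹ * y) x⁻¹ := h5
      simpa using this.inv_right
    have h7 : y⁻¹ * y' = (y'⁻¹ * y)⁻¹ := by group
    rw [h7]
    exact h6.inv_left.eq.symm
  -- `d` is injective on cosets, and a finite abelian group has as many characters as elements, so
  -- every character of the quotient is some `d y`.
  have hcard' : Nat.card ((E ⧸ center E) →* ℂˣ) = Nat.card (E ⧸ center E) :=
    CommGroup.card_monoidHom_of_hasEnoughRootsOfUnity _ _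
  have hfin : Finite ((E ⧸ center E) →* ℂˣ) :=
    Nat.finite_of_card_ne_zero (by rw [hcard']; exact Nat.card_pos.ne')
  let d' : E ⧸ center E → ((E ⧸ center E) →* ℂˣ) := fun v => d v.out
  have hd' : Function.Injective d' := fun v w hvw => by
    have := hd _ _ hvw
    simpa using this
  have hsurj := (Function.Injective.bijective_of_nat_card_le hd' hcard'.le).2
  obtain ⟨v, hv⟩ := hsurj (QuotientGroup.lift (center E) (j.comp f) (fun z hz => by
    rw [MonoidHom.mem_ker, MonoidHom.comp_apply, hf z hz, map_one]))
  refine ⟨v.out, fun x => ?_⟩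
  have := DFunLike.congr_fun hv (x : E ⧸ center E)
  have := hjinj (this : j (c v.out x) = j (f x))
  exact (congrArg Subtype.val this).symm

/-- Let `P` be a finite `p`-group, `p` odd, with a set `Γ` of automorphisms. If a `Γ`-invariant subgroup `D`
meets each `Γ`-invariant abelian normal subgroup trivially and each of these has at most one
subgroup of order `p`, then `D` is trivial. -/
theorem eq_one_of_mem_of_abelian_normal {p : ℕ} [Fact p.Prime] (hodd : Odd p) {P : Type*} [Group P]
    [Finite P] (hP : IsPGroup p P) (Γ : Set (MulAut P)) (D : Subgroup P)
    (hD : ∀ σ ∈ Γ, ∀ x ∈ D, σ x ∈ D)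
    (h : ∀ A : Subgroup P, A.Normal → (∀ σ ∈ Γ, ∀ x ∈ A, σ x ∈ A) →
      (∀ x ∈ A, ∀ y ∈ A, Commute x y) →
      (∀ x ∈ A, x ∈ D → x = 1) ∧
        ∀ x ∈ A, ∀ y ∈ A, x ^ p = 1 → y ^ p = 1 → y ≠ 1 → x ∈ zpowers y)
    (d : P) (hd : d ∈ D) : d = 1 := by
  have hp : p.Prime := Fact.out
  by_contra hd1
  have hnt : Nontrivial P := ⟨d, 1, hd1⟩
  -- elements of order `p`
  have hord : ∀ H : Subgroup P, H ≠ ⊥ → ∃ x ∈ H, x ≠ 1 ∧ x ^ p = 1 := by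
    intro H hH
    have : Nontrivial H := (Subgroup.nontrivial_iff_ne_bot H).2 hH
    obtain ⟨n, hn, hc⟩ := (hP.to_subgroup H).nontrivial_iff_card.1 this
    obtain ⟨x, hx⟩ := exists_prime_orderOf_dvd_card' (G := H) p (hc ▸ dvd_pow_self p hn.ne')
    refine ⟨x, x.2, fun h1 => hp.ne_one ?_, ?_⟩
    · rw [← hx, orderOf_eq_one_iff]; exact Subtype.ext h1
    · rw [← hx]; exact congrArg Subtype.val (pow_orderOf_eq_one x)
  have hcenter := h (center P) inferInstance
    (fun σ _ x hx => (characteristic_iff_map_le.1 inferInstance σ) ⟨x, hx, rfl⟩)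
    (fun x _ y hy => mem_center_iff.1 hy x)
  obtain ⟨z, hzc, hz1, hzp⟩ := hord (center P) (by
    have := hP.center_nontrivial
    exact (Subgroup.nontrivial_iff_ne_bot _).1 this)
  set Z := zpowers z with hZ
  have hZc : Z ≤ center P := zpowers_le.2 hzc
  have hZcomm : ∀ w ∈ Z, ∀ g, Commute w g := fun w hw g => (mem_center_iff.1 (hZc hw) g).symm
  have hZp : ∀ w ∈ Z, w ^ p = 1 := by
    rintro _ ⟨k, rfl⟩
    simp only
    rw [← zpow_natCast, ← zpow_mul, mul_comm, zpow_mul, zpow_natCast, hzp, one_zpow]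
  have hZmem : ∀ w ∈ center P, w ^ p = 1 → w ∈ Z := fun w hw hwp =>
    hcenter.2 w hw z hzc hwp hzp hz1
  have hZΓ : ∀ σ ∈ Γ, ∀ w ∈ Z, σ w ∈ Z := fun σ _ w hw =>
    hZmem _ ((characteristic_iff_map_le.1 inferInstance σ : map _ (center P) ≤ _)
      ⟨w, hZc hw, rfl⟩) (by rw [← map_pow, hZp w hw, map_one])
  have hZn : Z.Normal := ⟨fun w hw g => by
    rw [← (hZcomm w hw g).eq, mul_inv_cancel_right]; exact hw⟩
  have hq : ∀ x y : P, ⁅x, y⁆ ∈ Z ↔ Commute (x : P ⧸ Z) (y : P ⧸ Z) := fun x y => by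
    rw [← commutatorElement_eq_one_iff_commute, ← QuotientGroup.eq_one_iff]
    rfl
  have hσsurj : ∀ σ ∈ Γ, ∀ x, (∀ g, ⁅x, g⁆ ∈ Z) → ∀ g, ⁅σ x, g⁆ ∈ Z := by
    intro σ hσ x hx g
    have := hZΓ σ hσ _ (hx (σ.symm g))
    rwa [map_commutatorElement, MulEquiv.apply_symm_apply] at this
  -- The elements killed by `p` and central modulo `Z` form a subgroup because `p` is odd. All
  -- subgroups between `Z` and `E` are normal in `P`, so `h` applies to the abelian `Γ`-invariant
  -- ones.
  let E : Subgroup P :=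
    { carrier := {x | x ^ p = 1 ∧ ∀ g, ⁅x, g⁆ ∈ Z}
      one_mem' := ⟨one_pow _, fun g => by simp⟩
      mul_mem' := fun {x y} hx hy =>
        ⟨by rw [mul_pow_prime_of_central_commutator hp hodd (hZcomm _ (hy.2 x))
              (hZp _ (hy.2 x)), hx.1, hy.1, one_mul],
          fun g => (hq _ _).2 (((hq _ _).1 (hx.2 g)).mul_left ((hq _ _).1 (hy.2 g)))⟩
      inv_mem' := fun {x} hx => ⟨by rw [inv_pow, hx.1, inv_one],
          fun g => (hq _ _).2 ((hq _ _).1 (hx.2 g)).inv_left⟩ }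
  have hZE : Z ≤ E := fun w hw => ⟨hZp w hw, fun g => by
    rw [commutatorElement_eq_one_iff_commute.2 (hZcomm w hw g)]; exact Z.one_mem⟩
  have hEn : ∀ F : Subgroup P, Z ≤ F → F ≤ E → F.Normal := by
    refine fun F hZF hFE => ⟨fun x hx g => ?_⟩
    have : g * x * g⁻¹ = ⁅x, g⁆⁻¹ * x := by rw [commutatorElement_def]; group
    rw [this]
    exact F.mul_mem (hZF (Z.inv_mem ((hFE hx).2 g))) hx
  have hEΓ : ∀ σ ∈ Γ, ∀ x ∈ E, σ x ∈ E := fun σ hσ x hx =>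
    ⟨by rw [← map_pow, hx.1, map_one], hσsurj σ hσ x hx.2⟩
  have hsymm : ∀ σ ∈ Γ, ∀ F : Subgroup P, (∀ x ∈ F, σ x ∈ F) → ∀ x ∈ F, σ.symm x ∈ F := by
    intro σ _ F hF x hx
    have hmap : F.map σ.toMonoidHom = F :=
      Subgroup.eq_of_le_of_card_ge (by rintro _ ⟨y, hy, rfl⟩; exact hF y hy)
        (by rw [Subgroup.card_map_of_injective σ.injective])
    rw [← hmap] at hx
    obtain ⟨y, hy, rfl⟩ := hx
    simpa using hy
  -- the centre of `E`
  have hEZ : ∀ x ∈ E, (∀ y ∈ E, Commute x y) → x ∈ Z := by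
    have := h (E ⊓ centralizer E) (hEn _ (le_inf hZE fun w hw =>
        mem_centralizer_iff.2 fun y _ => (hZcomm w hw y).eq.symm) inf_le_left) ?_ ?_
    · intro x hx hxE
      refine this.2 x ⟨hx, mem_centralizer_iff.2 fun y hy => (hxE y hy).eq.symm⟩ z
        ⟨hZE (mem_zpowers z), mem_centralizer_iff.2 fun y _ => (hZcomm z (mem_zpowers z) y).eq.symm⟩
        hx.1 hzp hz1
    · rintro σ hσ x ⟨hx, hxc⟩
      refine ⟨hEΓ σ hσ x hx, mem_centralizer_iff.2 fun y hy => ?_⟩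
      have := mem_centralizer_iff.1 hxc _ (hsymm σ hσ E (hEΓ σ hσ) y hy)
      simpa using congrArg σ this
    · rintro x ⟨hx, hxc⟩ y ⟨hy, -⟩
      exact (mem_centralizer_iff.1 hxc y hy).symm
  -- `D` and `E` intersect trivially
  have hDE : ∀ x ∈ D, x ∈ E → x = 1 := by
    have hcommD : ∀ x ∈ D ⊓ E, ∀ y ∈ D ⊓ E, Commute x y := by
      rintro x ⟨hxD, hxE⟩ y ⟨hyD, hyE⟩
      rw [← commutatorElement_eq_one_iff_commute]
      refine hcenter.1 _ (hZc (hxE.2 y)) ?_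
      rw [commutatorElement_def]
      exact D.mul_mem (D.mul_mem (D.mul_mem hxD hyD) (D.inv_mem hxD)) (D.inv_mem hyD)
    -- `D ⊓ E` is abelian but need not be normal; its product with `Z` is both.
    have := h (Z ⊔ (D ⊓ E)) (hEn _ le_sup_left (sup_le hZE inf_le_right)) ?_ ?_
    · exact fun x hxD hxE => this.1 x ((le_sup_right : D ⊓ E ≤ Z ⊔ (D ⊓ E)) ⟨hxD, hxE⟩) hxD
    · intro σ hσ x hx
      obtain ⟨w, hw, y, hy, rfl⟩ := mem_sup_of_normal_left.1 hx
      rw [map_mul]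
      exact mul_mem ((le_sup_left : Z ≤ Z ⊔ (D ⊓ E)) (hZΓ σ hσ w hw))
        ((le_sup_right : D ⊓ E ≤ Z ⊔ (D ⊓ E)) ⟨hD σ hσ y hy.1, hEΓ σ hσ y hy.2⟩)
    · intro x hx y hy
      obtain ⟨w, hw, x', hx', rfl⟩ := mem_sup_of_normal_left.1 hx
      obtain ⟨v, hv, y', hy', rfl⟩ := mem_sup_of_normal_left.1 hy
      exact (hZcomm w hw _).mul_left
        (((hZcomm v hv x').symm).mul_right (hcommD x' hx' y' hy'))
  -- `P` is the product of `E` and its centralizer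
  have hER : ∀ g : P, ∃ e ∈ E, ∃ r ∈ centralizer (E : Set P), g = e * r := by
    intro g
    have hcE : ∀ x : E, x ∈ center E ↔ (x : P) ∈ Z := by
      intro x
      constructor
      · intro hx
        exact hEZ x x.2 fun y hy => (congrArg Subtype.val (mem_center_iff.1 hx ⟨y, hy⟩)).symm
      · intro hx
        exact mem_center_iff.2 fun y => Subtype.ext (hZcomm x hx y).eq.symm
    have hcard : Nat.card (center E) = p := by
      have h1 : Nat.card (center E) = Nat.card Z := by
        refine Nat.card_congr ⟨fun x => ⟨x.1, (hcE x.1).1 x.2⟩,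
          fun x => ⟨⟨x.1, hZE x.2⟩, (hcE ⟨x.1, hZE x.2⟩).2 x.2⟩, fun _ => rfl, fun _ => rfl⟩
      rw [h1, hZ, Nat.card_zpowers, orderOf_eq_prime hzp hz1]
    -- Commutation with `g` is a homomorphism from `E` to its centre, so it agrees with commutation
    -- by some `y` in `E`; then `y⁻¹ * g` centralizes `E`.
    let f : E →* center E :=
      { toFun := fun x => ⟨⟨⁅(x : P), g⁆, hZE (x.2.2 g)⟩, (hcE _).2 (x.2.2 g)⟩
        map_one' := by ext; simp
        map_mul' := fun a b => Subtype.ext <| Subtype.ext <|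
          commutator_mul_left_of_central (hZcomm _ (b.2.2 g)) }
    obtain ⟨y, hy⟩ := exists_commutator_eq (E := E) hcard
      (fun x y => (hcE _).2 (x.2.2 y)) f
      (fun w hw => by
        ext
        exact commutatorElement_eq_one_iff_commute.2 (hZcomm _ ((hcE w).1 hw) g))
    refine ⟨y, y.2, (y : P)⁻¹ * g, mem_centralizer_iff.2 fun x hx => ?_, by group⟩
    have h1 : ⁅x, g⁆ = ⁅x, (y : P)⁆ := congrArg Subtype.val (hy ⟨x, hx⟩)
    simp only [commutatorElement_def, mul_assoc] at h1
    have h2 := mul_left_cancel h1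
    have h3 : (y : P)⁻¹ * (g * (x⁻¹ * g⁻¹)) * g = x⁻¹ * ((y : P)⁻¹ * g) := by rw [h2]; group
    have h4 : Commute x⁻¹ ((y : P)⁻¹ * g) := by
      change _ = _
      rw [← h3]; group
    simpa using h4.inv_left.eq
  set R := centralizer (E : Set P) with hR
  have hZR : Z ≤ R := fun w hw => mem_centralizer_iff.2 fun y _ => (hZcomm w hw y).eq.symm
  have hΩR : ∀ x ∈ R, x ^ p = 1 → x ∈ Z := by
    intro x hx hxp
    have := mem_of_pow_prime_eq_one hodd (hP.to_subgroup R) (Z := Z.subgroupOf R)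
      (fun w hw g => Subtype.ext (hZcomm w (mem_subgroupOf.1 hw) g).eq)
      ⟨⟨z, hZR (mem_zpowers z)⟩, ?_⟩ (fun w hw => Subtype.ext (hZp w (mem_subgroupOf.1 hw))) ?_
      ⟨x, hx⟩ (Subtype.ext hxp)
    · exact mem_subgroupOf.1 this
    · ext w
      rw [mem_subgroupOf, hZ, mem_zpowers_iff, mem_zpowers_iff]
      simp [Subtype.ext_iff]
    -- As `P` is the product of `E` and `R`, and `y` commutes with `E`, being central modulo `Z` in
    -- `R` is the same as in `P`. So `y` lies in the centre of `E`, which is `Z`.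
    · intro y hyp hyR
      have hyE : (y : P) ∈ E := by
        refine ⟨congrArg Subtype.val hyp, fun g => ?_⟩
        obtain ⟨e, he, r, hr, rfl⟩ := hER g
        have h1 : Commute (y : P) e := (mem_centralizer_iff.1 y.2 e he).symm
        have h2 : ⁅(y : P), r⁆ ∈ Z := mem_subgroupOf.1 (hyR ⟨r, hr⟩)
        rw [hq] at h2 ⊢
        have h1' : Commute ((y : P) : P ⧸ Z) (e : P ⧸ Z) := h1.map (QuotientGroup.mk' Z)
        exact h1'.mul_right h2
      exact mem_subgroupOf.2 (hEZ y hyE fun e he => (mem_centralizer_iff.1 y.2 e he).symm)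
  -- For `x = e * r` of order `p` in `D`, the factor `r` is killed by `p`, so `r` is in `Z` and `x`
  -- falls into `D ⊓ E`.
  obtain ⟨x, hxD, hx1, hxp⟩ := hord D (by rintro rfl; exact hd1 (mem_bot.1 hd))
  obtain ⟨e, he, r, hr, rfl⟩ := hER x
  have her : Commute e r := mem_centralizer_iff.1 hr e he
  rw [her.mul_pow, he.1, one_mul] at hxp
  exact hx1 (hDE _ hxD (E.mul_mem he (hZE (hΩR r hr hxp))))

/-! ### Idempotents whose conjugates are orthogonal -/

theorem sum_comp_of_mapsTo {M : Type*} [AddCommMonoid M] (s : Finset M) {c : M → M}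
    (hc : Function.Injective c) (hs : ∀ x ∈ s, c x ∈ s) : ∑ x ∈ s, c x = ∑ x ∈ s, x := by
  classical
  have himg : s.image c = s :=
    Finset.eq_of_subset_of_card_le (Finset.image_subset_iff.2 hs)
      (Finset.card_image_of_injective s hc).ge
  conv_rhs => rw [← himg]
  rw [Finset.sum_image fun x _ y _ h => hc h]

theorem mem_normalizer_of_conj_mem {Λ : Type*} [Group Λ] [Finite Λ] {H : Subgroup Λ} {g : Λ}
    (h : ∀ x ∈ H, g * x * g⁻¹ ∈ H) : g ∈ normalizer (H : Set Λ) :=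
  Subgroup.mem_normalizer_fintype h

section OrthogonalIdempotent

variable {R : Type*} [Ring R]

/-- Conjugation of a ring element by a unit. -/
def unitConj (g : Rˣ) (e : R) : R := g * e * (g⁻¹ : Rˣ)

theorem unitConj_mul (g h : Rˣ) (e : R) : unitConj (g * h) e = unitConj g (unitConj h e) := by
  simp [unitConj, mul_assoc]

theorem unitConj_one (e : R) : unitConj 1 e = e := by simp [unitConj]

theorem unitConj_inv_conj (g : Rˣ) (e : R) : unitConj g⁻¹ (unitConj g e) = e := by
  rw [← unitConj_mul, inv_mul_cancel, unitConj_one]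

theorem unitConj_map_mul (g : Rˣ) (e f : R) :
    unitConj g (e * f) = unitConj g e * unitConj g f := by
  simp [unitConj, mul_assoc]

theorem unitConj_zero (g : Rˣ) : unitConj g (0 : R) = 0 := by simp [unitConj]

theorem unitConj_injective (g : Rˣ) : Function.Injective (unitConj g : R → R) :=
  Function.LeftInverse.injective (unitConj_inv_conj g)

theorem unitConj_eq_self {g : Rˣ} {e : R} : unitConj g e = e ↔ (g : R) * e = e * g := by
  rw [unitConj, Units.mul_inv_eq_iff_eq_mul]

theorem unitConj_sum (g : Rˣ) (s : Finset R) :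
    unitConj g (∑ x ∈ s, x) = ∑ x ∈ s, unitConj g x := by
  simp [unitConj, Finset.mul_sum, Finset.sum_mul]

/-- `e` is an idempotent, and each of its conjugates by elements of `G` is equal or orthogonal to
`e`. -/
structure IsOrthogonalIdempotent (G : Subgroup Rˣ) (e : R) : Prop where
  idem : e * e = e
  orth : ∀ g ∈ G, unitConj g e = e ∨ e * unitConj g e = 0

/-- The set of conjugates of `e` by elements of `H`. -/
def conjSet (H : Subgroup Rˣ) (e : R) : Set R := {x | ∃ h ∈ H, x = unitConj h e}

/-- The sum of the distinct conjugates of `e` by elements of `H`. -/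
noncomputable def conjSum [Finite R] (H : Subgroup Rˣ) (e : R) : R :=
  ∑ x ∈ (Set.toFinite (conjSet H e)).toFinset, x

theorem self_mem_conjSet (H : Subgroup Rˣ) (e : R) : e ∈ conjSet H e :=
  ⟨1, H.one_mem, (unitConj_one e).symm⟩

theorem unitConj_mem_conjSet {H : Subgroup Rˣ} {g : Rˣ} {e : R}
    (hg : ∀ h ∈ H, g * h * g⁻¹ ∈ H) (hge : unitConj g e ∈ conjSet H e) {x : R}
    (hx : x ∈ conjSet H e) : unitConj g x ∈ conjSet H e := by
  obtain ⟨h, hh, rfl⟩ := hx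
  obtain ⟨k, hk, hke⟩ := hge
  refine ⟨g * h * g⁻¹ * k, H.mul_mem (hg h hh) hk, ?_⟩
  rw [unitConj_mul _ k, ← hke, ← unitConj_mul, ← unitConj_mul]
  congr 1
  group

theorem unitConj_conjSum [Finite R] {H : Subgroup Rˣ} {g : Rˣ} {e : R}
    (hg : ∀ h ∈ H, g * h * g⁻¹ ∈ H) (hge : unitConj g e ∈ conjSet H e) :
    unitConj g (conjSum H e) = conjSum H e := by
  rw [conjSum, unitConj_sum]
  refine sum_comp_of_mapsTo _ (unitConj_injective g) fun x hx => ?_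
  rw [Set.Finite.mem_toFinset] at hx ⊢
  exact unitConj_mem_conjSet hg hge hx

theorem unitConj_conjSum_of_mem [Finite R] {H : Subgroup Rˣ} {g : Rˣ} (e : R) (hg : g ∈ H) :
    unitConj g (conjSum H e) = conjSum H e :=
  unitConj_conjSum (fun _ hh => H.mul_mem (H.mul_mem hg hh) (H.inv_mem hg)) ⟨g, hg, rfl⟩

namespace IsOrthogonalIdempotent

variable {G H : Subgroup Rˣ} {e : R}

theorem eq_or_mul_eq_zero (he : IsOrthogonalIdempotent G e) {g h : Rˣ} (hg : g ∈ G) (hh : h ∈ G) :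
    unitConj g e = unitConj h e ∨ unitConj g e * unitConj h e = 0 := by
  have key : unitConj h e = unitConj g (unitConj (g⁻¹ * h) e) := by
    rw [← unitConj_mul, mul_inv_cancel_left]
  rcases he.orth (g⁻¹ * h) (G.mul_mem (G.inv_mem hg) hh) with h1 | h1
  · left; rw [key, h1]
  · right; rw [key, ← unitConj_map_mul, h1, unitConj_zero]

theorem mono (he : IsOrthogonalIdempotent G e) (hHG : H ≤ G) : IsOrthogonalIdempotent H e :=
  ⟨he.idem, fun g hg => he.orth g (hHG hg)⟩

theorem unitConj (he : IsOrthogonalIdempotent G e) {g : Rˣ} (hg : g ∈ G) :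
    IsOrthogonalIdempotent G (unitConj g e) := by
  refine ⟨by rw [← unitConj_map_mul, he.idem], fun h hh => ?_⟩
  rw [← unitConj_mul]
  exact (he.eq_or_mul_eq_zero hg (G.mul_mem hh hg)).imp Eq.symm id

theorem idem_of_mem (he : IsOrthogonalIdempotent G e) {x : R} (hx : x ∈ conjSet G e) :
    x * x = x := by
  obtain ⟨g, hg, rfl⟩ := hx
  rw [← unitConj_map_mul, he.idem]

theorem mul_eq_zero_of_mem (he : IsOrthogonalIdempotent G e) {x y : R} (hx : x ∈ conjSet G e)
    (hy : y ∈ conjSet G e) (hxy : x ≠ y) : x * y = 0 := by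
  obtain ⟨g, hg, rfl⟩ := hx
  obtain ⟨h, hh, rfl⟩ := hy
  exact (he.eq_or_mul_eq_zero hg hh).resolve_left hxy

variable [Finite R]

theorem mul_conjSum (he : IsOrthogonalIdempotent G e) {x : R} (hx : x ∈ conjSet G e) :
    x * conjSum G e = x := by
  rw [conjSum, Finset.mul_sum, Finset.sum_eq_single x, he.idem_of_mem hx]
  · exact fun y hy hyx => he.mul_eq_zero_of_mem hx ((Set.Finite.mem_toFinset _).1 hy) hyx.symm
  · exact fun h => absurd ((Set.Finite.mem_toFinset _).2 hx) h

theorem conjSum_mul (he : IsOrthogonalIdempotent G e) {x : R} (hx : x ∈ conjSet G e) :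
    conjSum G e * x = x := by
  rw [conjSum, Finset.sum_mul, Finset.sum_eq_single x, he.idem_of_mem hx]
  · exact fun y hy hyx => he.mul_eq_zero_of_mem ((Set.Finite.mem_toFinset _).1 hy) hx hyx
  · exact fun h => absurd ((Set.Finite.mem_toFinset _).2 hx) h

theorem conjSum_idem (he : IsOrthogonalIdempotent G e) :
    conjSum G e * conjSum G e = conjSum G e := by
  conv_lhs => lhs; rw [conjSum]
  rw [Finset.sum_mul]
  exact Finset.sum_congr rfl fun x hx => he.mul_conjSum ((Set.Finite.mem_toFinset _).1 hx)

theorem conjSum_ne_zero (he : IsOrthogonalIdempotent G e) (h0 : e ≠ 0) : conjSum G e ≠ 0 := by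
  intro h
  have := he.mul_conjSum (self_mem_conjSet G e)
  rw [h, mul_zero] at this
  exact h0 this.symm

end IsOrthogonalIdempotent

theorem conjSet_mono {H G : Subgroup Rˣ} (hHG : H ≤ G) (e : R) : conjSet H e ⊆ conjSet G e :=
  fun _ ⟨h, hh, hx⟩ => ⟨h, hHG hh, hx⟩

theorem conjSet_conj_mem {G : Subgroup Rˣ} {e x : R} (hx : x ∈ conjSet G e) {g : Rˣ} (hg : g ∈ G) :
    unitConj g x ∈ conjSet G e := by
  obtain ⟨h, hh, rfl⟩ := hx
  exact ⟨g * h, G.mul_mem hg hh, (unitConj_mul g h e).symm⟩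

/-- The sum of the conjugates under a normal subgroup is again an orthogonal idempotent. -/
theorem IsOrthogonalIdempotent.conjSum [Finite R] {H G : Subgroup Rˣ} {e : R}
    (he : IsOrthogonalIdempotent G e) (hHG : H ≤ G) (hn : ∀ g ∈ G, ∀ h ∈ H, g * h * g⁻¹ ∈ H) :
    IsOrthogonalIdempotent G (conjSum H e) := by
  refine ⟨(he.mono hHG).conjSum_idem, fun g hg => ?_⟩
  by_cases hge : CoprimeAction.unitConj g e ∈ conjSet H e
  · exact Or.inl (unitConj_conjSum (hn g hg) hge)
  · right
    rw [CoprimeAction.conjSum, unitConj_sum, Finset.sum_mul]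
    refine Finset.sum_eq_zero fun x hx => ?_
    rw [Finset.mul_sum]
    refine Finset.sum_eq_zero fun y hy => ?_
    rw [Set.Finite.mem_toFinset] at hx hy
    refine he.mul_eq_zero_of_mem (conjSet_mono hHG e hx)
      (conjSet_conj_mem (conjSet_mono hHG e hy) hg) ?_
    rintro rfl
    obtain ⟨h, hh, hx⟩ := hx
    obtain ⟨k, hk, rfl⟩ := hy
    refine hge ⟨(g * k * g⁻¹)⁻¹ * h, H.mul_mem (H.inv_mem (hn g hg k hk)) hh, ?_⟩
    rw [unitConj_mul _ h, ← hx, ← unitConj_mul, ← unitConj_mul]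
    congr 1
    group

/-! ### Fixed vectors -/

variable {T : Type*} [AddCommGroup T] [Module R T]

/-- The image of an idempotent. -/
def fixedBy (T : Type*) [AddCommGroup T] [Module R T] (e : R) : AddSubgroup T where
  carrier := {t | e • t = t}
  zero_mem' := smul_zero e
  add_mem' := fun {a b} ha hb => by
    change e • (a + b) = a + b
    rw [smul_add, show e • a = a from ha, show e • b = b from hb]
  neg_mem' := fun {a} ha => by
    change e • (-a) = -a
    rw [smul_neg, show e • a = a from ha]

theorem mem_fixedBy {e : R} {t : T} : t ∈ fixedBy T e ↔ e • t = t := Iff.rfl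

theorem smul_mem_fixedBy {e : R} {g : Rˣ} (h : unitConj g e = e) {t : T} (ht : t ∈ fixedBy T e) :
    g • t ∈ fixedBy T e := by
  rw [mem_fixedBy, Units.smul_def, smul_smul, ← unitConj_eq_self.1 h, mul_smul, mem_fixedBy.1 ht]

theorem fixedBy_ne_top [FaithfulSMul R T] {e : R} (h : e ≠ 1) : fixedBy T e ≠ ⊤ := by
  intro htop
  refine h (FaithfulSMul.eq_of_smul_eq_smul (α := T) fun t => ?_)
  rw [one_smul]
  exact mem_fixedBy.1 (htop ▸ AddSubgroup.mem_top t)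

/-- A `q`-group acting on a nonzero elementary abelian `q`-group has a nonzero fixed vector. -/
theorem exists_fixed_ne_zero [Finite T] {q : ℕ} [Fact q.Prime] (hT : ∀ t : T, q • t = 0)
    {Q : Subgroup Rˣ} (hQ : IsPGroup q Q) (W : AddSubgroup T) (hW : W ≠ ⊥)
    (hQW : ∀ g ∈ Q, ∀ w ∈ W, g • w ∈ W) : ∃ w ∈ W, w ≠ 0 ∧ ∀ g ∈ Q, g • w = w := by
  let _ : MulAction Q W :=
    { smul := fun g w => ⟨(g : Rˣ) • (w : T), hQW g g.2 w w.2⟩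
      one_smul := fun w => Subtype.ext (one_smul Rˣ (w : T))
      mul_smul := fun g h w => Subtype.ext (mul_smul (g : Rˣ) (h : Rˣ) (w : T)) }
  have hdvd : q ∣ Nat.card W := by
    obtain ⟨w, hw, hw0⟩ := (AddSubgroup.bot_or_exists_ne_zero W).resolve_left hW
    have hord : addOrderOf (⟨w, hw⟩ : W) = q :=
      addOrderOf_eq_prime (Subtype.ext (hT w)) fun h => hw0 (congrArg Subtype.val h)
    rw [← hord]
    exact addOrderOf_dvd_natCard _
  have h0 : (0 : W) ∈ MulAction.fixedPoints Q W := fun g => Subtype.ext (smul_zero (g : Rˣ))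
  obtain ⟨w, hw, hne⟩ := hQ.exists_fixed_point_of_prime_dvd_card_of_fixed_point W hdvd h0
  exact ⟨w, w.2, fun h => hne (Subtype.ext h.symm),
    fun g hg => congrArg Subtype.val (hw ⟨g, hg⟩)⟩

/-- An element of odd order does not invert a nonzero vector of odd prime order. -/
theorem eq_zero_of_smul_eq_neg {p q : ℕ} (hp : Odd p) (hq : Odd q) {M : Subgroup Rˣ}
    (hM : IsPGroup p M) {m : Rˣ} (hm : m ∈ M) {u : T} (hu : q • u = 0) (h : m • u = -u) : u = 0 := by
  -- Every odd power of `m` negates `u`, and the identity is an odd power of `m`.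
  have hpow : ∀ n : ℕ, m ^ (2 * n + 1) • u = -u := by
    intro n
    induction n with
    | zero => simpa using h
    | succ n ih =>
      rw [show 2 * (n + 1) + 1 = (2 * n + 1) + 1 + 1 by ring, pow_succ', pow_succ', mul_smul,
        mul_smul, ih, smul_neg, h, neg_neg, h]
  obtain ⟨k, hk⟩ := hM ⟨m, hm⟩
  have hk' : m ^ p ^ k = 1 := congrArg Subtype.val hk
  obtain ⟨n, hn⟩ := hp.pow (n := k)
  have h1 := hpow n
  rw [← hn, hk', one_smul] at h1
  have h2 : (2 : ℕ) • u = 0 := by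
    rw [two_nsmul]; nth_rewrite 2 [h1]; exact add_neg_cancel u
  obtain ⟨l, rfl⟩ := hq
  rw [add_smul, mul_comm, mul_smul, h2, smul_zero, zero_add, one_smul] at hu
  exact hu

end OrthogonalIdempotent

/-! ### Regular vectors from proper orthogonal idempotents -/

section Imprimitive

variable {R : Type*} [Ring R] {T : Type*} [AddCommGroup T] [Module R T]
  [FaithfulSMul R T] [Finite T]

/-- A regular fixed vector is assembled from the conjugates of an image `e T` that is stable
under `P` and permuted by `Q`. -/
theorem exists_regular_of_commute [Finite R] {P Q : Subgroup Rˣ}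
    (hPQ : ∀ g ∈ Q, ∀ x ∈ P, g * x * g⁻¹ ∈ P) {e : R} (he : IsOrthogonalIdempotent Q e)
    (h0 : e ≠ 0) (h1 : e ≠ 1) (hPe : ∀ x ∈ P, unitConj x e = e)
    (hind : ∀ (W : AddSubgroup T) (Q' : Subgroup Rˣ), W ≠ ⊤ → Q' ≤ Q →
      (∀ x ∈ P, ∀ w ∈ W, x • w ∈ W) → (∀ g ∈ Q', ∀ w ∈ W, g • w ∈ W) →
      ∃ τ ∈ W, (∀ g ∈ Q', g • τ = τ) ∧ ∀ x ∈ P, x • τ = τ → ∀ w ∈ W, x • w = w) :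
    ∃ τ : T, (∀ g ∈ Q, g • τ = τ) ∧ ∀ x ∈ P, x • τ = τ → x = 1 := by
  classical
  set f := conjSum Q e with hf
  have hef : e * f = e := he.mul_conjSum (self_mem_conjSet Q e)
  have hfQ : ∀ g ∈ Q, unitConj g f = f := fun g hg => unitConj_conjSum_of_mem e hg
  have hPconj : ∀ x ∈ P, ∀ g ∈ Q, unitConj x (unitConj g e) = unitConj g e := by
    intro x hx g hg
    have h2 := hPe _ (hPQ g⁻¹ (Q.inv_mem hg) x hx)
    rw [← unitConj_mul, show x * g = g * (g⁻¹ * x * g⁻¹⁻¹) by group, unitConj_mul, h2]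
  have hfP : ∀ x ∈ P, unitConj x f = f := by
    intro x hx
    rw [hf, conjSum, unitConj_sum]
    refine Finset.sum_congr rfl fun y hy => ?_
    obtain ⟨g, hg, rfl⟩ := (Set.Finite.mem_toFinset _).1 hy
    exact hPconj x hx g hg
  have hone_sub : ∀ g : Rˣ, unitConj g f = f → unitConj g (1 - f) = 1 - f := by
    intro g hg
    rw [unitConj_eq_self] at hg ⊢
    rw [mul_sub, sub_mul, hg, one_mul, mul_one]
  -- Only the stabilizer `Q₁` of `e` in `Q` acts on `e T`, so `τ₁` is chosen there relative to `Q₁`,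
  -- and `τ₂` in the complement `(1 - f) T` relative to `Q`.
  let Q₁ : Subgroup Rˣ :=
    { carrier := {g | g ∈ Q ∧ unitConj g e = e}
      one_mem' := ⟨Q.one_mem, unitConj_one e⟩
      mul_mem' := fun {a b} ha hb => ⟨Q.mul_mem ha.1 hb.1, by rw [unitConj_mul, hb.2, ha.2]⟩
      inv_mem' := fun {a} ha => ⟨Q.inv_mem ha.1, by
        conv_lhs => rw [← ha.2]
        exact unitConj_inv_conj a e⟩ }
  obtain ⟨τ₁, hτ₁, hQτ₁, hPτ₁⟩ := hind (fixedBy T e) Q₁ (fixedBy_ne_top h1) (fun g hg => hg.1)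
    (fun x hx w hw => smul_mem_fixedBy (hPe x hx) hw) (fun g hg w hw => smul_mem_fixedBy hg.2 hw)
  obtain ⟨τ₂, hτ₂, hQτ₂, hPτ₂⟩ := hind (fixedBy T (1 - f)) Q
    (fixedBy_ne_top fun h => he.conjSum_ne_zero h0 (by simpa using h)) le_rfl
    (fun x hx w hw => smul_mem_fixedBy (hone_sub x (hfP x hx)) hw)
    (fun g hg w hw => smul_mem_fixedBy (hone_sub g (hfQ g hg)) hw)
  rw [mem_fixedBy] at hτ₁ hτ₂
  have hfτ₂ : f • τ₂ = 0 := by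
    rw [sub_smul, one_smul, sub_eq_self] at hτ₂
    exact hτ₂
  -- Summing over distinct translates counts each coset of `Q₁` once, so the component of the sum in
  -- `e T` is exactly `τ₁`.
  let O : Finset T := (Set.toFinite {v : T | ∃ g ∈ Q, v = g • τ₁}).toFinset
  have hO : ∀ v, v ∈ O ↔ ∃ g ∈ Q, v = g • τ₁ := fun v => by simp [O]
  set τ' := ∑ v ∈ O, v with hτ'
  have hQτ' : ∀ g ∈ Q, g • τ' = τ' := by
    intro g hg
    rw [hτ', Finset.smul_sum]
    refine sum_comp_of_mapsTo O (c := fun v => g • v) (MulAction.injective g) fun v hv => ?_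
    obtain ⟨h, hh, rfl⟩ := (hO v).1 hv
    exact (hO _).2 ⟨g * h, Q.mul_mem hg hh, (mul_smul g h τ₁).symm⟩
  have hgτ₁ : ∀ g : Rˣ, unitConj g e • (g • τ₁) = g • τ₁ := by
    intro g
    rw [Units.smul_def, smul_smul, unitConj, Units.inv_mul_cancel_right, mul_smul, hτ₁]
  have heτ' : e • τ' = τ₁ := by
    rw [hτ', Finset.smul_sum, Finset.sum_eq_single τ₁, hτ₁]
    · intro v hv hne
      obtain ⟨g, hg, rfl⟩ := (hO v).1 hv
      rcases he.orth g hg with h2 | h2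
      · exact absurd (hQτ₁ g ⟨hg, h2⟩) hne
      · rw [← hgτ₁, smul_smul, h2, zero_smul]
    · exact fun h => absurd ((hO _).2 ⟨1, Q.one_mem, (one_smul _ _).symm⟩) h
  have hfτ' : f • τ' = τ' := by
    rw [hτ', Finset.smul_sum]
    refine Finset.sum_congr rfl fun v hv => ?_
    obtain ⟨g, hg, rfl⟩ := (hO v).1 hv
    conv_lhs => rw [← hgτ₁, smul_smul, he.conjSum_mul ⟨g, hg, rfl⟩, hgτ₁]
  refine ⟨τ₂ + τ', fun g hg => by rw [smul_add, hQτ₂ g hg, hQτ' g hg], fun x hx hxτ => ?_⟩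
  have hcomm : ∀ (a : R) (y : Rˣ) (t : T), unitConj y a = a → y • t = t → y • a • t = a • t := by
    intro a y t hya hyt
    rw [Units.smul_def, smul_smul, unitConj_eq_self.1 hya, mul_smul, ← Units.smul_def, hyt]
  have heτ : e • (τ₂ + τ') = τ₁ := by
    rw [smul_add, heτ', ← hef, mul_smul, hfτ₂, smul_zero, zero_add]
  have hx₂ : x • τ₂ = τ₂ := by
    have := hcomm (1 - f) x _ (hone_sub x (hfP x hx)) hxτ
    rwa [smul_add, hτ₂, sub_smul, one_smul, hfτ', sub_self, add_zero] at this
  -- Since `Q` fixes the vector, `g⁻¹ * x * g` fixes it too, hence fixes its `e`-component `τ₁` and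
  -- acts trivially on `e T`. Conjugating back, `x` is trivial on the block of `unitConj g e`.
  have hxe : ∀ g ∈ Q, ∀ t : T, x • (unitConj g e • t) = unitConj g e • t := by
    intro g hg t
    have hy : g⁻¹ * x * g ∈ P := by simpa using hPQ g⁻¹ (Q.inv_mem hg) x hx
    have hyτ : (g⁻¹ * x * g) • (τ₂ + τ') = τ₂ + τ' := by
      have h2 : ∀ h ∈ Q, h • (τ₂ + τ') = τ₂ + τ' := fun h hh => by
        rw [smul_add, hQτ₂ h hh, hQτ' h hh]
      rw [mul_smul, mul_smul, h2 g hg, hxτ, h2 _ (Q.inv_mem hg)]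
    have h3 := hcomm e _ _ (hPe _ hy) hyτ
    rw [heτ] at h3
    have h4 := hPτ₁ _ hy h3 (e • (g⁻¹ • t)) (by rw [mem_fixedBy, smul_smul, he.idem])
    have h5 : unitConj g e • t = g • e • g⁻¹ • t := by
      simp only [unitConj, mul_smul, Units.smul_def]
    rw [mul_smul, mul_smul, inv_smul_eq_iff] at h4
    rw [h5, h4]
  refine Units.ext (FaithfulSMul.eq_of_smul_eq_smul (α := T) fun t => ?_)
  rw [Units.val_one, one_smul, ← Units.smul_def]
  have hxf : x • (f • t) = f • t := by
    rw [hf, conjSum, Finset.sum_smul, Finset.smul_sum]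
    refine Finset.sum_congr rfl fun y hy => ?_
    obtain ⟨g, hg, rfl⟩ := (Set.Finite.mem_toFinset _).1 hy
    exact hxe g hg t
  have hx1f : x • ((1 - f) • t) = (1 - f) • t := by
    refine hPτ₂ x hx hx₂ _ ?_
    rw [mem_fixedBy, smul_smul]
    congr 1
    have := he.conjSum_idem
    rw [← hf] at this
    rw [mul_sub, mul_one, sub_mul, one_mul, this, sub_self, sub_zero]
  have hsplit : t = (1 - f) • t + f • t := by rw [sub_smul, one_smul, sub_add_cancel]
  rw [hsplit, smul_add, hx1f, hxf]

/-- The case of an idempotent fixed by `Q` and by a maximal `Q`-invariant subgroup `M` of `P`, whose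
other conjugates under `P` are orthogonal to it. -/
theorem exists_regular_of_maximal {p q : ℕ} [Fact q.Prime] (hp : Odd p) (hq : Odd q)
    (hT : ∀ t : T, q • t = 0) {P Q M : Subgroup Rˣ} (hP : IsPGroup p P) (hQ : IsPGroup q Q)
    (hPQ : ∀ g ∈ Q, ∀ x ∈ P, g * x * g⁻¹ ∈ P)
    (hMP : M ≤ P) (hMn : ∀ g ∈ P, ∀ x ∈ M, g * x * g⁻¹ ∈ M)
    (hMQ : ∀ g ∈ Q, ∀ x ∈ M, g * x * g⁻¹ ∈ M)
    (hmax : ∀ N : Subgroup Rˣ, M ≤ N → N ≤ P → (∀ g ∈ Q, ∀ x ∈ N, g * x * g⁻¹ ∈ N) →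
      N = M ∨ N = P)
    {e : R} (hidem : e * e = e) (h0 : e ≠ 0) (hMe : ∀ x ∈ M, unitConj x e = e)
    (hQe : ∀ g ∈ Q, unitConj g e = e) (horth : ∀ g ∈ P, g ∉ M → e * unitConj g e = 0)
    (hind : ∃ τ : T, (∀ g ∈ Q, g • τ = τ) ∧ ∀ x ∈ M, x • τ = τ → x = 1) :
    ∃ τ : T, (∀ g ∈ Q, g • τ = τ) ∧ ∀ x ∈ P, x • τ = τ → x = 1 := by
  have hcomm : ∀ (y : Rˣ) (t : T), unitConj y e = e → y • e • t = e • y • t := by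
    intro y t hy
    simp only [Units.smul_def, smul_smul]
    rw [unitConj_eq_self.1 hy]
  obtain ⟨τ, hQτ, hMτ, heτ⟩ : ∃ τ : T, (∀ g ∈ Q, g • τ = τ) ∧ (∀ x ∈ M, x • τ = τ → x = 1) ∧
      e • τ ≠ 0 := by
    obtain ⟨τ, hQτ, hMτ⟩ := hind
    -- If the `e`-component vanishes, a nonzero `Q`-fixed vector of `e T` is added; `M` preserves
    -- both components, so regularity for `M` survives.
    by_cases heτ : e • τ = 0
    · have hW : fixedBy T e ≠ ⊥ := by
        intro hbot
        refine h0 (FaithfulSMul.eq_of_smul_eq_smul (α := T) fun t => ?_)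
        rw [zero_smul, ← AddSubgroup.mem_bot, ← hbot, mem_fixedBy, smul_smul, hidem]
      obtain ⟨w, hw, hw0, hQw⟩ := exists_fixed_ne_zero hT hQ (fixedBy T e) hW
        (fun g hg w hw => smul_mem_fixedBy (hQe g hg) hw)
      rw [mem_fixedBy] at hw
      refine ⟨τ + w, fun g hg => by rw [smul_add, hQτ g hg, hQw g hg], fun x hx hxw => ?_, by
        rwa [smul_add, heτ, hw, zero_add]⟩
      have h2 := congrArg (e • ·) hxw
      simp only [← hcomm x _ (hMe x hx), smul_add, heτ, hw, zero_add, smul_zero] at h2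
      rw [smul_add, h2] at hxw
      exact hMτ x hx (add_right_cancel hxw)
    · exact ⟨τ, hQτ, hMτ, heτ⟩
  by_cases htriv : ∀ x ∈ P, x • τ = τ → x = 1
  · exact ⟨τ, hQτ, htriv⟩
  push Not at htriv
  obtain ⟨d, hdP, hdτ, hd1⟩ := htriv
  -- `P` is generated by `M` and the stabilizer of `τ`
  have hMD : ∀ g ∈ P, ∃ m ∈ M, g • τ = m • τ := by
    let N : Subgroup Rˣ :=
      { carrier := {g | g ∈ P ∧ ∃ m ∈ M, g • τ = m • τ}
        one_mem' := ⟨P.one_mem, 1, M.one_mem, rfl⟩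
        mul_mem' := fun {a b} ha hb => by
          obtain ⟨haP, m, hm, ham⟩ := ha
          obtain ⟨hbP, n, hn, hbn⟩ := hb
          refine ⟨P.mul_mem haP hbP, a * n * a⁻¹ * m, M.mul_mem (hMn a haP n hn) hm, ?_⟩
          rw [mul_smul, hbn, mul_smul _ m, ← ham, ← mul_smul, ← mul_smul]
          congr 1; group
        inv_mem' := fun {a} ha => by
          obtain ⟨haP, m, hm, ham⟩ := ha
          refine ⟨P.inv_mem haP, a⁻¹ * m⁻¹ * a⁻¹⁻¹, hMn _ (P.inv_mem haP) _ (M.inv_mem hm), ?_⟩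
          rw [inv_inv, mul_smul, ham, mul_smul, inv_smul_smul] }
    have hN := hmax N (fun m hm => ⟨hMP hm, m, hm, rfl⟩) (fun g hg => hg.1) (by
      rintro g hg x ⟨hxP, m, hm, hxm⟩
      refine ⟨hPQ g hg x hxP, g * m * g⁻¹, hMQ g hg m hm, ?_⟩
      rw [mul_smul, mul_smul, mul_smul, mul_smul, hQτ _ (Q.inv_mem hg), hxm])
    rcases hN with hN | hN
    · have hdN : d ∈ N := ⟨hdP, 1, M.one_mem, by rw [hdτ, one_smul]⟩
      rw [hN] at hdN
      exact absurd (hMτ d hdN hdτ) hd1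
    · intro g hg
      rw [← hN] at hg
      exact hg.2
  -- The new vector is `τ` with the sign of its `e`-component reversed. An element of `M` fixing it
  -- fixes `τ`. For `x` outside `M`, `e` kills `x • e • τ`; with `x • τ = m • τ`, comparing
  -- `e`-components shows that `m` inverts `e • τ`, impossible in odd characteristic for `m` of odd
  -- order.
  have hee : e • (τ - (2 : ℕ) • e • τ) = - (e • τ) := by
    rw [smul_sub, smul_comm e (2 : ℕ), smul_smul, hidem, two_nsmul]; abel
  refine ⟨τ - (2 : ℕ) • e • τ, fun g hg => ?_, fun x hx hxτ => ?_⟩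
  · rw [smul_sub, smul_comm g (2 : ℕ), hcomm g _ (hQe g hg), hQτ g hg]
  by_cases hxM : x ∈ M
  · have h2 : x • e • τ = e • τ := by
      have := congrArg (e • ·) hxτ
      simp only [← hcomm x _ (hMe x hxM), hee, smul_neg, neg_inj] at this
      exact this
    rw [smul_sub, smul_comm x (2 : ℕ), h2] at hxτ
    exact hMτ x hxM (sub_left_injective hxτ)
  · exfalso
    obtain ⟨m, hm, hxm⟩ := hMD x hx
    have h2 : e • x • e • τ = 0 := by
      have : e • x • e • τ = (e * unitConj x e) • x • τ := by
        simp only [Units.smul_def, smul_smul, unitConj, mul_assoc, Units.inv_mul, mul_one]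
      rw [this, horth x hx hxM, zero_smul]
    have h3 := congrArg (e • ·) hxτ
    simp only [hee] at h3
    rw [smul_sub, smul_sub, smul_comm x (2 : ℕ), smul_comm e (2 : ℕ), h2, smul_zero, sub_zero, hxm,
      ← hcomm m _ (hMe m hm)] at h3
    exact heτ (eq_zero_of_smul_eq_neg hp hq (hP.to_le hMP) hm (hT _) h3)

/-- A maximal proper `Q`-invariant subgroup of a finite `p`-group `P` is normal in `P`. -/
theorem exists_maximal_invariant {Λ : Type*} [Group Λ] [Finite Λ] {p : ℕ} [Fact p.Prime]
    {P Q P₁ : Subgroup Λ} (hP : IsPGroup p P) (hPQ : ∀ g ∈ Q, ∀ x ∈ P, g * x * g⁻¹ ∈ P)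
    (hle : P₁ < P) (hP₁ : ∀ g ∈ Q, ∀ x ∈ P₁, g * x * g⁻¹ ∈ P₁) :
    ∃ M : Subgroup Λ, P₁ ≤ M ∧ M < P ∧ (∀ g ∈ P, ∀ x ∈ M, g * x * g⁻¹ ∈ M) ∧
      (∀ g ∈ Q, ∀ x ∈ M, g * x * g⁻¹ ∈ M) ∧
      ∀ N : Subgroup Λ, M ≤ N → N ≤ P → (∀ g ∈ Q, ∀ x ∈ N, g * x * g⁻¹ ∈ N) → N = M ∨ N = P := by
  obtain ⟨M, hPM, ⟨hMP, hMQ⟩, hMmax⟩ := (Set.toFinite {M : Subgroup Λ | M < P ∧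
    ∀ g ∈ Q, ∀ x ∈ M, g * x * g⁻¹ ∈ M}).exists_le_maximal (a := P₁) ⟨hle, hP₁⟩
  have hmax : ∀ N : Subgroup Λ, M ≤ N → N ≤ P → (∀ g ∈ Q, ∀ x ∈ N, g * x * g⁻¹ ∈ N) →
      N = M ∨ N = P := by
    intro N hMN hNP hNQ
    by_cases h : N = P
    · exact Or.inr h
    · exact Or.inl (le_antisymm (hMmax ⟨lt_of_le_of_ne hNP h, hNQ⟩ hMN) hMN)
  refine ⟨M, hPM, hMP, ?_, hMQ, hmax⟩
  -- The normalizer of `M` in `P` is `Q`-invariant, hence `M` or `P`; the first is excluded because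
  -- normalizers grow in nilpotent groups.
  have hN := hmax (normalizer (M : Set Λ) ⊓ P) (le_inf le_normalizer hMP.le) inf_le_right (by
    rintro g hg x ⟨hx, hxP⟩
    have hgM : g ∈ normalizer (M : Set Λ) := mem_normalizer_of_conj_mem (hMQ g hg)
    exact ⟨Subgroup.mul_mem _ (Subgroup.mul_mem _ hgM hx) (Subgroup.inv_mem _ hgM), hPQ g hg x hxP⟩)
  rcases hN with hN | hN
  · exfalso
    have := hP.isNilpotent
    have hlt : M.subgroupOf P < ⊤ := by
      rw [lt_top_iff_ne_top, Ne, subgroupOf_eq_top]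
      exact hMP.not_ge
    have h2 := Group.normalizerCondition_of_isNilpotent (G := P) _ hlt
    obtain ⟨x, hx, hxM⟩ := SetLike.exists_of_lt h2
    refine hxM (mem_subgroupOf.2 ?_)
    rw [← hN]
    refine ⟨mem_normalizer_of_conj_mem fun y hy => ?_, x.2⟩
    exact mem_subgroupOf.1 ((mem_normalizer_iff.1 hx ⟨y, hMP.le hy⟩).1 (mem_subgroupOf.2 hy))
  · intro g hg x hx
    rw [← hN] at hg
    exact (mem_normalizer_iff.1 hg.1 x).1 hx

/-- The dichotomy is whether the `P`-conjugates of `e` sum to `1`. If not, their sum is a proper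
idempotent commuting with `P`. If so, `Q` permutes these conjugates, whose number is a power of `p`,
and so fixes one; its stabilizer in `P` is proper and lies in a maximal `Q`-invariant subgroup. -/
theorem exists_regular_of_orthogonalIdempotent [Finite R] {p q : ℕ} [Fact p.Prime] [Fact q.Prime]
    (hp : Odd p) (hq : Odd q) (hpq : p ≠ q)
    (hT : ∀ t : T, q • t = 0) {P Q : Subgroup Rˣ} (hP : IsPGroup p P) (hQ : IsPGroup q Q)
    (hPQ : ∀ g ∈ Q, ∀ x ∈ P, g * x * g⁻¹ ∈ P)
    {e : R} (he : IsOrthogonalIdempotent (P ⊔ Q) e) (h0 : e ≠ 0) (h1 : e ≠ 1)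
    (hsub : ∀ (W : AddSubgroup T) (Q' : Subgroup Rˣ), W ≠ ⊤ → Q' ≤ Q →
      (∀ x ∈ P, ∀ w ∈ W, x • w ∈ W) → (∀ g ∈ Q', ∀ w ∈ W, g • w ∈ W) →
      ∃ τ ∈ W, (∀ g ∈ Q', g • τ = τ) ∧ ∀ x ∈ P, x • τ = τ → ∀ w ∈ W, x • w = w)
    (hind : ∀ M : Subgroup Rˣ, M < P → (∀ g ∈ Q, ∀ x ∈ M, g * x * g⁻¹ ∈ M) →
      ∃ τ : T, (∀ g ∈ Q, g • τ = τ) ∧ ∀ x ∈ M, x • τ = τ → x = 1) :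
    ∃ τ : T, (∀ g ∈ Q, g • τ = τ) ∧ ∀ x ∈ P, x • τ = τ → x = 1 := by
  have hPG : P ≤ P ⊔ Q := le_sup_left
  have hQG : Q ≤ P ⊔ Q := le_sup_right
  have hGP : ∀ g ∈ P ⊔ Q, ∀ x ∈ P, g * x * g⁻¹ ∈ P := by
    have : P ⊔ Q ≤ normalizer (P : Set Rˣ) :=
      sup_le le_normalizer fun g hg => mem_normalizer_of_conj_mem (hPQ g hg)
    exact fun g hg x hx => (mem_normalizer_iff.1 (this hg) x).1 hx
  by_cases hs : conjSum P e = 1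
  swap
  · exact exists_regular_of_commute hPQ ((he.conjSum hPG hGP).mono hQG)
      ((he.mono hPG).conjSum_ne_zero h0) hs (fun x hx => unitConj_conjSum_of_mem e hx) hsub
  -- `Q` permutes the conjugates of `e` under `P`
  have hQset : ∀ g ∈ Q, ∀ x ∈ conjSet P e, unitConj g x ∈ conjSet P e := by
    intro g hg x hx
    by_contra hcon
    -- A conjugate outside the set would be orthogonal to all its members, whose sum is `1`.
    have hx0 : unitConj g x = 0 := by
      rw [← one_mul (unitConj g x), ← hs, conjSum, Finset.sum_mul]
      refine Finset.sum_eq_zero fun y hy => ?_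
      rw [Set.Finite.mem_toFinset] at hy
      refine he.mul_eq_zero_of_mem (conjSet_mono hPG e hy)
        (conjSet_conj_mem (conjSet_mono hPG e hx) (hQG hg)) ?_
      rintro rfl
      exact hcon hy
    obtain ⟨h, hh, rfl⟩ := hx
    rw [← unitConj_mul] at hx0
    exact h0 (unitConj_injective _ (hx0.trans (unitConj_zero _).symm))
  obtain ⟨k, hk, hkQ⟩ : ∃ k ∈ P, ∀ g ∈ Q, unitConj g (unitConj k e) = unitConj k e := by
    let _ : MulAction Q (conjSet P e) :=
      { smul := fun g x => ⟨unitConj (g : Rˣ) (x : R), hQset g g.2 x x.2⟩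
        one_smul := fun x => Subtype.ext (unitConj_one (x : R))
        mul_smul := fun g h x => Subtype.ext (unitConj_mul (g : Rˣ) (h : Rˣ) (x : R)) }
    let _ : MulAction P (conjSet P e) :=
      { smul := fun g x => ⟨unitConj (g : Rˣ) (x : R), conjSet_conj_mem x.2 g.2⟩
        one_smul := fun x => Subtype.ext (unitConj_one (x : R))
        mul_smul := fun g h x => Subtype.ext (unitConj_mul (g : Rˣ) (h : Rˣ) (x : R)) }
    have htrans : MulAction.IsPretransitive P (conjSet P e) := by
      rw [MulAction.isPretransitive_iff_base (⟨e, self_mem_conjSet P e⟩ : conjSet P e)]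
      rintro ⟨_, h, hh, rfl⟩
      exact ⟨⟨h, hh⟩, rfl⟩
    have hndvd : ¬ q ∣ Nat.card (conjSet P e) := by
      intro hdvd
      have hidx := MulAction.index_stabilizer_of_transitive P
        (⟨e, self_mem_conjSet P e⟩ : conjSet P e)
      obtain ⟨n, hn⟩ := IsPGroup.iff_card.1 hP
      have h3 : q ∣ p ^ n := by
        rw [← hn]
        exact (hdvd.trans (dvd_of_eq hidx.symm)).trans (Subgroup.index_dvd_card _)
      have h4 := (Fact.out : q.Prime).dvd_of_dvd_pow h3
      exact hpq ((Nat.prime_dvd_prime_iff_eq Fact.out Fact.out).1 h4).symm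
    obtain ⟨⟨_, k, hk, rfl⟩, hfix⟩ :=
      hQ.nonempty_fixed_point_of_prime_not_dvd_card (conjSet P e) hndvd
    exact ⟨k, hk, fun g hg => congrArg Subtype.val (hfix ⟨g, hg⟩)⟩
  set e' := unitConj k e with he'
  have hoe' : IsOrthogonalIdempotent (P ⊔ Q) e' := he.unitConj (hPG hk)
  have h0' : e' ≠ 0 := fun h => h0 (unitConj_injective k (h.trans (unitConj_zero k).symm))
  let P₁ : Subgroup Rˣ :=
    { carrier := {g | g ∈ P ∧ unitConj g e' = e'}
      one_mem' := ⟨P.one_mem, unitConj_one e'⟩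
      mul_mem' := fun {a b} ha hb => ⟨P.mul_mem ha.1 hb.1, by rw [unitConj_mul, hb.2, ha.2]⟩
      inv_mem' := fun {a} ha => ⟨P.inv_mem ha.1, by
        conv_lhs => rw [← ha.2]
        exact unitConj_inv_conj a e'⟩ }
  have hP₁P : P₁ < P := by
    refine lt_of_le_of_ne (fun g hg => hg.1) fun heq => h1 ?_
    have hall : ∀ g ∈ P, unitConj g e' = e' := fun g hg => by
      rw [← heq] at hg; exact hg.2
    have hee' : e = e' := by
      rw [← hall k⁻¹ (P.inv_mem hk), he', unitConj_inv_conj]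
    have hset : conjSet P e = {e} := by
      refine Set.eq_singleton_iff_unique_mem.2 ⟨self_mem_conjSet P e, ?_⟩
      rintro _ ⟨h, hh, rfl⟩
      rw [hee', hall h hh]
    rw [← hs, conjSum]
    simp [hset]
  have hP₁Q : ∀ g ∈ Q, ∀ x ∈ P₁, g * x * g⁻¹ ∈ P₁ := by
    rintro g hg x ⟨hxP, hxe⟩
    refine ⟨hPQ g hg x hxP, ?_⟩
    rw [unitConj_mul, unitConj_mul, hkQ _ (Q.inv_mem hg), hxe, hkQ g hg]
  obtain ⟨M, hPM, hMP, hMn, hMQ, hmax⟩ := exists_maximal_invariant hP hPQ hP₁P hP₁Q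
  have hoM := hoe'.mono (hMP.le.trans hPG)
  -- Summing `e'` over its `M`-conjugates gives an idempotent fixed by `M`. Conjugating by `g`
  -- outside `M` produces only other conjugates of `e'`, since the stabilizer of `e'` lies in `M`.
  refine exists_regular_of_maximal hp hq hT hP hQ hPQ hMP.le hMn hMQ hmax hoM.conjSum_idem
    (hoM.conjSum_ne_zero h0') (fun x hx => unitConj_conjSum_of_mem e' hx)
    (fun g hg => unitConj_conjSum (hMQ g hg) (by rw [hkQ g hg]; exact self_mem_conjSet M e'))
    (fun g hg hgM => ?_) (hind M hMP hMQ)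
  rw [conjSum, unitConj_sum, Finset.sum_mul]
  refine Finset.sum_eq_zero fun x hx => ?_
  rw [Finset.mul_sum]
  refine Finset.sum_eq_zero fun y hy => ?_
  rw [Set.Finite.mem_toFinset] at hx hy
  obtain ⟨m, hm, rfl⟩ := hx
  obtain ⟨n, hn, rfl⟩ := hy
  rw [← unitConj_mul g n]
  refine (hoe'.eq_or_mul_eq_zero (hPG (hMP.le hm))
    (hPG (P.mul_mem hg (hMP.le hn)))).resolve_left fun heq => hgM ?_
  have h2 : m⁻¹ * (g * n) ∈ M := by
    refine hPM ⟨P.mul_mem (P.inv_mem (hMP.le hm)) (P.mul_mem hg (hMP.le hn)), ?_⟩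
    rw [unitConj_mul, ← heq, unitConj_inv_conj]
  have h3 := M.mul_mem (M.mul_mem hm h2) (M.inv_mem hn)
  rwa [mul_inv_cancel_left, mul_inv_cancel_right] at h3

end Imprimitive

universe u

/-! ### Semiregular abelian subgroups and the main induction -/

theorem exists_nsmul_inverse {T : Type*} [AddCommGroup T] {q n : ℕ} (hq : 1 < q)
    (hT : ∀ t : T, q • t = 0) (hn : n.Coprime q) : ∃ c : ℕ, ∀ t : T, (c * n) • t = t := by
  obtain ⟨c, -, hc⟩ := Nat.exists_mul_mod_eq_one_of_coprime hn hq
  refine ⟨c, fun t => ?_⟩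
  rw [mul_comm, ← Nat.div_add_mod (n * c) q, hc, add_smul, mul_comm, mul_smul, hT, smul_zero,
    zero_add, one_smul]

theorem coprime_card_of_isPGroup {p q : ℕ} [Fact p.Prime] [Fact q.Prime] (hpq : p ≠ q)
    {B : Type*} [Group B] [Finite B] (hB : IsPGroup p B) : (Nat.card B).Coprime q := by
  obtain ⟨n, hn⟩ := IsPGroup.iff_card.1 hB
  rw [hn]
  exact Nat.Coprime.pow_left n ((Nat.coprime_primes Fact.out Fact.out).2 hpq)

section Semiregular

variable {R : Type*} [Ring R] {T : Type*} [AddCommGroup T] [Module R T]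
  [FaithfulSMul R T]

/-- Take `B ≤ A` maximal with a nonzero fixed vector, and let `e` be the average over `B`, which
projects onto the fixed vectors of `B`. If `e * unitConj g e` is nonzero, its image contains a
nonzero vector fixed by `B` and by its conjugate under `g`, so maximality makes the two equal and
`g` fixes `e`. Thus `e` is orthogonal; but `e ≠ 0` as `B` fixes a nonzero vector, and `e ≠ 1` as `B`
is nontrivial. -/
theorem eq_one_of_smul_eq_of_primitive [Finite R] {p q : ℕ} [Fact p.Prime] [Fact q.Prime] (hpq : p ≠ q)
    (hT : ∀ t : T, q • t = 0) {A G : Subgroup Rˣ} (hA : IsPGroup p A)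
    (hAcomm : ∀ x ∈ A, ∀ y ∈ A, Commute x y) (hAG : ∀ g ∈ G, ∀ x ∈ A, g * x * g⁻¹ ∈ A)
    (hprim : ∀ e : R, IsOrthogonalIdempotent G e → e = 0 ∨ e = 1) {a : Rˣ} (ha : a ∈ A) {t : T}
    (ht : t ≠ 0) (hat : a • t = t) : a = 1 := by
  by_contra ha1
  obtain ⟨B, haB, ⟨hBA, t₀, ht₀, hBt₀⟩, hBmax⟩ := (Set.toFinite {B : Subgroup Rˣ | B ≤ A ∧
    ∃ t : T, t ≠ 0 ∧ ∀ b ∈ B, b • t = t}).exists_le_maximal (a := zpowers a)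
    ⟨zpowers_le.2 ha, t, ht, fun b hb =>
      (zpowers_le.2 (MulAction.mem_stabilizer_iff.2 hat) : _ ≤ MulAction.stabilizer Rˣ t) hb⟩
  obtain ⟨c, hc⟩ := exists_nsmul_inverse (Fact.out : q.Prime).one_lt hT
    (coprime_card_of_isPGroup hpq (hA.to_le hBA))
  let s : Finset R := (Set.toFinite (Units.val '' (B : Set Rˣ))).toFinset
  have hs : ∀ x, x ∈ s ↔ ∃ b ∈ B, (b : R) = x := fun x => by simp [s]
  have hcard : s.card = Nat.card B := by
    rw [← Nat.card_eq_card_finite_toFinset, Nat.card_image_of_injective Units.val_injective]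
    rfl
  set e : R := c • ∑ x ∈ s, x with he
  have hbe : ∀ b ∈ B, (b : R) * e = e := by
    intro b hb
    rw [he, mul_smul_comm, Finset.mul_sum, sum_comp_of_mapsTo s (c := fun x => (b : R) * x)
      b.isUnit.mul_right_injective]
    intro x hx
    obtain ⟨b', hb', rfl⟩ := (hs x).1 hx
    exact (hs _).2 ⟨b * b', B.mul_mem hb hb', Units.val_mul b b'⟩
  have hfix : ∀ t : T, (∀ b ∈ B, b • t = t) → e • t = t := by
    intro t ht
    rw [he, smul_assoc, Finset.sum_smul]
    have : ∑ x ∈ s, x • t = ∑ x ∈ s, t := Finset.sum_congr rfl fun x hx => by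
      obtain ⟨b, hb, rfl⟩ := (hs x).1 hx
      exact ht b hb
    rw [this, Finset.sum_const, hcard, ← mul_smul, hc]
  have hbet : ∀ b ∈ B, ∀ t : T, b • e • t = e • t := fun b hb t => by
    rw [Units.smul_def, smul_smul, hbe b hb]
  have hidem : e * e = e := FaithfulSMul.eq_of_smul_eq_smul (α := T) fun t => by
    rw [mul_smul]
    exact hfix _ fun b hb => hbet b hb t
  have hconj : ∀ g : Rˣ, (∀ b ∈ B, g * b * g⁻¹ ∈ B) → unitConj g e = e := by
    intro g hg
    have : unitConj g e = c • unitConj g (∑ x ∈ s, x) := by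
      rw [he, unitConj, unitConj, mul_smul_comm, smul_mul_assoc]
    rw [this, unitConj_sum, sum_comp_of_mapsTo s (unitConj_injective g), he]
    intro x hx
    obtain ⟨b, hb, rfl⟩ := (hs x).1 hx
    exact (hs _).2 ⟨g * b * g⁻¹, hg b hb, by simp [unitConj]⟩
  have hcomm : ∀ x ∈ A, unitConj x e = e := fun x hx => hconj x fun b hb => by
    rw [(hAcomm x hx b (hBA hb)).eq, mul_inv_cancel_right]; exact hb
  have horth : IsOrthogonalIdempotent G e := by
    refine ⟨hidem, fun g hg => ?_⟩
    by_cases h0 : e * unitConj g e = 0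
    · exact Or.inr h0
    left
    obtain ⟨t, ht⟩ : ∃ t : T, (e * unitConj g e) • t ≠ 0 := by
      by_contra! hcon
      exact h0 (FaithfulSMul.eq_of_smul_eq_smul (α := T) fun t => by rw [hcon, zero_smul])
    have hle : B ⊔ B.map (MulAut.conj g).toMonoidHom ≤ B := by
      refine hBmax ⟨sup_le hBA ?_, _, ht, ?_⟩ le_sup_left
      · rintro _ ⟨b, hb, rfl⟩
        exact hAG g hg b (hBA hb)
      · suffices B ⊔ B.map (MulAut.conj g).toMonoidHom ≤
            MulAction.stabilizer Rˣ ((e * unitConj g e) • t) from fun b hb => this hb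
        refine sup_le (fun b hb => ?_) ?_
        · rw [MulAction.mem_stabilizer_iff, mul_smul]
          exact hbet b hb _
        · rintro _ ⟨b, hb, rfl⟩
          rw [MulAction.mem_stabilizer_iff, Units.smul_def, smul_smul]
          congr 1
          change ((g * b * g⁻¹ : Rˣ) : R) * (e * unitConj g e) = _
          -- As `A` is abelian, `g * b * g⁻¹` commutes with `e` and can be absorbed by the second
          -- factor.
          rw [← mul_assoc, unitConj_eq_self.1 (hcomm _ (hAG g hg b (hBA hb))), mul_assoc]
          congr 1
          rw [unitConj, Units.val_mul, Units.val_mul]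
          calc (g : R) * b * (g⁻¹ : Rˣ) * (g * e * (g⁻¹ : Rˣ)) = g * (b * e) * (g⁻¹ : Rˣ) := by
                simp only [mul_assoc, Units.inv_mul_cancel_left]
            _ = g * e * (g⁻¹ : Rˣ) := by rw [hbe b hb]
    exact hconj g fun b hb => hle ((le_sup_right : B.map (MulAut.conj g).toMonoidHom ≤ _)
      ⟨b, hb, rfl⟩)
  rcases hprim e horth with h | h
  · refine ht₀ ?_
    rw [← hfix t₀ hBt₀, h, zero_smul]
  · have := hbe a (haB (mem_zpowers a))
    rw [h, mul_one] at this
    exact ha1 (Units.ext this)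

/-- A commutative group acting semiregularly has at most one subgroup of order `p`. -/
theorem mem_zpowers_of_semiregular [Nontrivial T] {p q : ℕ} [Fact p.Prime] [Fact q.Prime]
    (hpq : p ≠ q) (hT : ∀ t : T, q • t = 0) {A : Subgroup Rˣ}
    (hAcomm : ∀ x ∈ A, ∀ y ∈ A, Commute x y)
    (hreg : ∀ a ∈ A, ∀ t : T, t ≠ 0 → a • t = t → a = 1) {x y : Rˣ} (hx : x ∈ A) (hy : y ∈ A)
    (hxp : x ^ p = 1) (hyp : y ^ p = 1) (hy1 : y ≠ 1) : x ∈ zpowers y := by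
  by_contra hxy
  -- The geometric sum takes values in vectors fixed by `w`, which are zero by semiregularity.
  have hsum : ∀ w ∈ A, w ^ p = 1 → w ≠ 1 → ∑ j ∈ Finset.range p, (w : R) ^ j = 0 := by
    intro w hw hwp hw1
    refine FaithfulSMul.eq_of_smul_eq_smul (α := T) fun t => ?_
    rw [zero_smul]
    by_contra hne
    refine hw1 (hreg w hw _ hne ?_)
    rw [Units.smul_def, smul_smul]
    congr 1
    have h1 := mul_geom_sum (w : R) p
    have h2 : (w : R) ^ p = 1 := by rw [← Units.val_pow_eq_pow_val, hwp, Units.val_one]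
    rw [h2, sub_self, sub_mul, one_mul, sub_eq_zero] at h1
    exact h1
  have hcomm : Commute (x : R) (y : R) := Commute.units_val (hAcomm x hx y hy)
  -- A double count: for each `i` the inner sum vanishes, as `x * y ^ i ≠ 1`; in the other order
  -- only `j = 0` survives and contributes `p`, which is invertible on `T`.
  have h1 : ∑ i ∈ Finset.range p, ∑ j ∈ Finset.range p, ((x * y ^ i : Rˣ) : R) ^ j = 0 := by
    refine Finset.sum_eq_zero fun i _ => hsum _ (A.mul_mem hx (A.pow_mem hy i)) ?_ fun h => hxy ?_
    · rw [(hAcomm x hx _ (A.pow_mem hy i)).mul_pow, hxp, ← pow_mul, mul_comm i, pow_mul, hyp,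
        one_pow, one_mul]
    · rw [eq_inv_of_mul_eq_one_left h]
      exact inv_mem (pow_mem (mem_zpowers y) i)
  rw [Finset.sum_comm, Finset.sum_eq_single 0] at h1
  · simp only [pow_zero, Finset.sum_const, Finset.card_range, nsmul_eq_mul, mul_one] at h1
    obtain ⟨t, ht⟩ := exists_ne (0 : T)
    obtain ⟨c, hc⟩ := exists_nsmul_inverse (Fact.out : q.Prime).one_lt hT
      ((Nat.coprime_primes Fact.out Fact.out).2 hpq)
    apply ht
    rw [← hc t, mul_smul, ← Nat.cast_smul_eq_nsmul R p, h1, zero_smul, smul_zero]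
  · intro j hj hj0
    have h2 : ∀ i ∈ Finset.range p,
        ((x * y ^ i : Rˣ) : R) ^ j = (x : R) ^ j * ((y ^ j : Rˣ) : R) ^ i := by
      intro i _
      rw [Units.val_mul, Units.val_pow_eq_pow_val, Units.val_pow_eq_pow_val,
        (hcomm.pow_right i).mul_pow, ← pow_mul, ← pow_mul, mul_comm i]
    rw [Finset.sum_congr rfl h2, ← Finset.mul_sum, hsum _ (A.pow_mem hy j) ?_ ?_, mul_zero]
    · rw [← pow_mul, mul_comm, pow_mul, hyp, one_pow]
    · intro h3
      have := orderOf_dvd_of_pow_eq_one h3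
      rw [orderOf_eq_prime hyp hy1] at this
      exact absurd (Nat.le_of_dvd (Nat.pos_of_ne_zero hj0) this)
        (not_le.2 (Finset.mem_range.1 hj))
  · intro h
    exact absurd (Finset.mem_range.2 (Fact.out : p.Prime).pos) h

/-- Without proper orthogonal idempotents, each nonzero vector fixed by `Q` is regular for `P`. -/
theorem eq_one_of_primitive [Finite R] {p q : ℕ} [Fact p.Prime] [Fact q.Prime] (hp : Odd p)
    (hpq : p ≠ q) (hT : ∀ t : T, q • t = 0) {P Q : Subgroup Rˣ} (hP : IsPGroup p P)
    (hPQ : ∀ g ∈ Q, ∀ x ∈ P, g * x * g⁻¹ ∈ P)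
    (hprim : ∀ e : R, IsOrthogonalIdempotent (P ⊔ Q) e → e = 0 ∨ e = 1) {τ : T} (hτ : τ ≠ 0)
    (hQτ : ∀ g ∈ Q, g • τ = τ) {x : Rˣ} (hx : x ∈ P) (hxτ : x • τ = τ) : x = 1 := by
  have hnt : Nontrivial T := ⟨τ, 0, hτ⟩
  -- `Γ` consists of the conjugations by `Q`, and `D` is the stabilizer of `τ`, which they preserve
  -- because `Q` fixes `τ`.
  have key := eq_one_of_mem_of_abelian_normal hp hP
    {σ : MulAut P | ∃ g ∈ Q, ∀ y : P, ((σ y : P) : Rˣ) = g * y * g⁻¹}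
    (MulAction.stabilizer P τ) ?_ ?_ ⟨x, hx⟩ hxτ
  · exact congrArg Subtype.val key
  · rintro σ ⟨g, hg, hσ⟩ y hy
    change ((σ y : P) : Rˣ) • τ = τ
    have hy' : (y : Rˣ) • τ = τ := hy
    rw [hσ, mul_smul, mul_smul, hQτ _ (Q.inv_mem hg), hy', hQτ g hg]
  · intro A hAn hAσ hAcomm
    have hAcomm' : ∀ y ∈ A.map P.subtype, ∀ z ∈ A.map P.subtype, Commute y z := by
      rintro _ ⟨y, hy, rfl⟩ _ ⟨z, hz, rfl⟩
      exact (hAcomm y hy z hz).map P.subtype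
    have hnorm : ∀ g ∈ P ⊔ Q, ∀ y ∈ A.map P.subtype, g * y * g⁻¹ ∈ A.map P.subtype := by
      have hle : P ⊔ Q ≤ normalizer (A.map P.subtype : Set Rˣ) := by
        refine sup_le (fun g hg => ?_) fun g hg => ?_
        · refine mem_normalizer_of_conj_mem ?_
          rintro _ ⟨y, hy, rfl⟩
          exact ⟨_, hAn.conj_mem y hy ⟨g, hg⟩, rfl⟩
        · refine mem_normalizer_of_conj_mem ?_
          rintro _ ⟨y, hy, rfl⟩
          let σ : MulAut P :=
            { toFun := fun y => ⟨g * y * g⁻¹, hPQ g hg y y.2⟩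
              invFun := fun y => ⟨g⁻¹ * y * g, by simpa using hPQ g⁻¹ (Q.inv_mem hg) y y.2⟩
              left_inv := fun y => Subtype.ext (by simp [mul_assoc])
              right_inv := fun y => Subtype.ext (by simp [mul_assoc])
              map_mul' := fun y z => Subtype.ext (by simp [mul_assoc]) }
          exact ⟨σ y, hAσ σ ⟨g, hg, fun _ => rfl⟩ y hy, rfl⟩
      exact fun g hg y hy => (mem_normalizer_iff.1 (hle hg) y).1 hy
    have hreg : ∀ a ∈ A.map P.subtype, ∀ t : T, t ≠ 0 → a • t = t → a = 1 :=
      fun a ha t ht hat => eq_one_of_smul_eq_of_primitive hpq hT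
        (hP.to_le (map_subtype_le A)) hAcomm' hnorm hprim ha ht hat
    refine ⟨fun y hy hyτ => ?_, fun y hy z hz hyp hzp hz1 => ?_⟩
    · exact Subtype.ext (hreg y ⟨y, hy, rfl⟩ τ hτ hyτ)
    · obtain ⟨k, hk⟩ := mem_zpowers_iff.1 <| mem_zpowers_of_semiregular hpq hT hAcomm' hreg
        (x := y) (y := z) ⟨y, hy, rfl⟩ ⟨z, hz, rfl⟩ (congrArg Subtype.val hyp)
        (congrArg Subtype.val hzp) (fun h => hz1 (Subtype.ext h))
      exact mem_zpowers_iff.2 ⟨k, Subtype.ext (by simpa using hk)⟩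

end Semiregular

/-- The group of units stabilizing a subgroup `W`, acting on `W`. -/
theorem exists_restrict {T : Type*} [AddCommGroup T] (W : AddSubgroup T) :
    ∃ (K : Subgroup (AddMonoid.End T)ˣ) (f : K →* (AddMonoid.End W)ˣ),
      (∀ g, g ∈ K ↔ ∀ w ∈ W, g • w ∈ W ∧ g⁻¹ • w ∈ W) ∧
      ∀ (g : K) (w : W), ((f g • w : W) : T) = (g : (AddMonoid.End T)ˣ) • (w : T) := by
  let K : Subgroup (AddMonoid.End T)ˣ :=
    { carrier := {g | ∀ w ∈ W, g • w ∈ W ∧ g⁻¹ • w ∈ W}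
      one_mem' := fun w hw => by simpa using hw
      mul_mem' := fun {a b} ha hb w hw => by
        rw [mul_smul, mul_inv_rev, mul_smul]
        exact ⟨(ha _ (hb w hw).1).1, (hb _ (ha w hw).2).2⟩
      inv_mem' := fun {a} ha w hw => by
        rw [inv_inv]
        exact (ha w hw).symm }
  let _ : DistribMulAction K W :=
    { smul := fun g w => ⟨(g : (AddMonoid.End T)ˣ) • (w : T), (g.2 w w.2).1⟩
      one_smul := fun w => Subtype.ext (one_smul _ (w : T))
      mul_smul := fun g h w => Subtype.ext (mul_smul (g : (AddMonoid.End T)ˣ) h (w : T))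
      smul_zero := fun g => Subtype.ext (smul_zero (g : (AddMonoid.End T)ˣ))
      smul_add := fun g v w => Subtype.ext (smul_add (g : (AddMonoid.End T)ˣ) (v : T) w) }
  exact ⟨K, (DistribMulAction.toAddMonoidEnd K W).toHomUnits, fun g => Iff.rfl, fun g w => rfl⟩

/-- If `Q` is a `q`-group normalizing a `p`-group `P` of automorphisms of a finite elementary abelian
`q`-group, then `Q` fixes a vector on which `P` acts regularly. -/
theorem exists_regular_fixed_vector {p q : ℕ} [Fact p.Prime] [Fact q.Prime]
    (hp : Odd p) (hq : Odd q) (hpq : p ≠ q) (N : ℕ) :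
    ∀ (T : Type u) [AddCommGroup T] [Finite T], Nat.card T = N → (∀ t : T, q • t = 0) →
      ∀ (P Q : Subgroup (AddMonoid.End T)ˣ), IsPGroup p P → IsPGroup q Q →
      (∀ g ∈ Q, ∀ x ∈ P, g * x * g⁻¹ ∈ P) →
      ∃ τ : T, (∀ g ∈ Q, g • τ = τ) ∧ ∀ x ∈ P, x • τ = τ → x = 1 := by
  induction N using Nat.strong_induction_on with
  | _ N ih =>
  intro T _ _ hN hT P Q hP hQ hPQ
  have : Finite (AddMonoid.End T) := DFunLike.finite _
  induction hk : Nat.card P using Nat.strong_induction_on generalizing P with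
  | _ k ihP =>
  subst hk
  by_cases hprim : ∀ e : AddMonoid.End T, IsOrthogonalIdempotent (P ⊔ Q) e → e = 0 ∨ e = 1
  · by_cases htop : (⊤ : AddSubgroup T) = ⊥
    · refine ⟨0, fun g _ => smul_zero g, fun x _ _ => ?_⟩
      refine Units.ext (FaithfulSMul.eq_of_smul_eq_smul (α := T) fun t => ?_)
      have h0 : ∀ t : T, t = 0 := fun t => by
        rw [← AddSubgroup.mem_bot, ← htop]; exact AddSubgroup.mem_top t
      rw [h0 (_ • t), h0 (((1 : (AddMonoid.End T)ˣ) : AddMonoid.End T) • t)]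
    · obtain ⟨τ, -, hτ, hQτ⟩ := exists_fixed_ne_zero hT hQ ⊤ htop
        (fun g _ w _ => AddSubgroup.mem_top _)
      exact ⟨τ, hQτ, fun x hx hxτ => eq_one_of_primitive hp hpq hT hP hPQ hprim hτ hQτ hx hxτ⟩
  push Not at hprim
  obtain ⟨e, he, h0, h1⟩ := hprim
  refine exists_regular_of_orthogonalIdempotent hp hq hpq hT hP hQ hPQ he h0 h1 ?_ ?_
  -- `P` need not act faithfully on `W`, so induction is applied to the images in `End W` and yields
  -- triviality on `W` only.
  · intro W Q' hW hQ' hPW hQW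
    obtain ⟨K, f, hK, hf⟩ := exists_restrict W
    have hPK : P ≤ K := fun x hx => (hK x).2 fun w hw => ⟨hPW x hx w hw, hPW _ (P.inv_mem hx) w hw⟩
    have hQK : Q' ≤ K := fun x hx =>
      (hK x).2 fun w hw => ⟨hQW x hx w hw, hQW _ (Q'.inv_mem hx) w hw⟩
    have hlt : Nat.card W < N := by
      rw [← hN]
      exact lt_of_le_of_ne (AddSubgroup.card_le_card_addGroup W)
        fun h => hW (AddSubgroup.eq_top_of_card_eq W h)
    obtain ⟨τ, hQτ, hPτ⟩ := ih _ hlt W rfl (fun t => Subtype.ext (hT t))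
      ((P.subgroupOf K).map f) ((Q'.subgroupOf K).map f) (hP.comap_subtype.map f)
      ((hQ.to_le hQ').comap_subtype.map f) (by
        rintro _ ⟨g, hg, rfl⟩ _ ⟨x, hx, rfl⟩
        exact ⟨g * x * g⁻¹, mem_subgroupOf.2 (hPQ g (hQ' hg) x hx), by simp⟩)
    refine ⟨τ, τ.2, fun g hg => ?_, fun x hx hxτ w hw => ?_⟩
    · rw [← hf ⟨g, hQK hg⟩ τ, hQτ _ ⟨⟨g, hQK hg⟩, hg, rfl⟩]
    · have h2 := hPτ (f ⟨x, hPK hx⟩) ⟨⟨x, hPK hx⟩, hx, rfl⟩ (Subtype.ext (by rw [hf]; exact hxτ))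
      have h3 := hf ⟨x, hPK hx⟩ ⟨w, hw⟩
      rw [h2, one_smul] at h3
      exact h3.symm
  · intro M hMP hMQ
    refine ihP _ ?_ M (hP.to_le hMP.le) hMQ rfl
    refine lt_of_le_of_ne (Subgroup.card_le_of_le hMP.le) fun h => hMP.ne ?_
    exact Subgroup.eq_of_le_of_card_ge hMP.le h.ge

/-! ### Actions of semidirect products -/

theorem exists_stabilizer_eq_range_inr {p q : ℕ} [Fact p.Prime] [Fact q.Prime] (hp : Odd p)
    (hq : Odd q) (hpq : p ≠ q) {P Q : Type*} [Group P] [Group Q] (hP : IsPGroup p P)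
    (hQ : IsPGroup q Q) {φ : Q →* MulAut P} {T : Type*} [AddCommGroup T] [Finite T]
    (hT : ∀ t : T, q • t = 0) (ρ : P ⋊[φ] Q →* AddMonoid.End T)
    (hρ : Function.Injective (ρ.comp SemidirectProduct.inl)) :
    ∃ τ : T, ∀ g, ρ g τ = τ ↔ g ∈ (SemidirectProduct.inr : Q →* P ⋊[φ] Q).range := by
  let f : P ⋊[φ] Q →* (AddMonoid.End T)ˣ := ρ.toHomUnits
  have hf : ∀ g t, f g • t = ρ g t := fun g t => rfl
  obtain ⟨τ, hQτ, hPτ⟩ := exists_regular_fixed_vector hp hq hpq _ T rfl hT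
    (f.comp SemidirectProduct.inl).range (f.comp SemidirectProduct.inr).range
    (hP.of_surjective _ (MonoidHom.rangeRestrict_surjective _))
    (hQ.of_surjective _ (MonoidHom.rangeRestrict_surjective _)) (by
      rintro _ ⟨g, rfl⟩ _ ⟨x, rfl⟩
      refine ⟨φ g x, ?_⟩
      simp only [MonoidHom.comp_apply]
      rw [SemidirectProduct.inl_aut, map_mul, map_mul, map_inv, map_inv])
  have hQ' : ∀ g : Q, ρ (SemidirectProduct.inr g) τ = τ := fun g => hQτ _ ⟨g, rfl⟩
  refine ⟨τ, fun g => ⟨fun hg => ?_, ?_⟩⟩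
  · have hfix : f (SemidirectProduct.inl g.left) • τ = τ := by
      rw [hf]
      conv_rhs => rw [← hg, ← SemidirectProduct.inl_left_mul_inr_right g, map_mul]
      exact congrArg _ (hQ' g.right).symm
    have h1 := hPτ _ ⟨g.left, rfl⟩ hfix
    have h2 : g.left = 1 := by
      refine hρ ?_
      rw [map_one]
      exact congrArg Units.val h1
    refine ⟨g.right, ?_⟩
    conv_rhs => rw [← SemidirectProduct.inl_left_mul_inr_right g, h2, map_one, one_mul]
  · rintro ⟨g, rfl⟩
    exact hQ' g

/-- The sum of the translates by `P` of a vector fixed by `Q` is fixed by the semidirect product. -/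
theorem map_sum_inl_eq {P Q : Type*} [Group P] [Group Q] [Fintype P] {φ : Q →* MulAut P}
    {T : Type*} [AddCommGroup T] (ρ : P ⋊[φ] Q →* AddMonoid.End T) {τ : T}
    (hτ : ∀ g : Q, ρ (SemidirectProduct.inr g) τ = τ) (g : P ⋊[φ] Q) :
    ρ g (∑ x : P, ρ (SemidirectProduct.inl x) τ) = ∑ x : P, ρ (SemidirectProduct.inl x) τ := by
  have hmul : ∀ (a b : P ⋊[φ] Q) (t : T), ρ a (ρ b t) = ρ (a * b) t := fun a b t => by
    rw [map_mul]; rfl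
  have hinr : ∀ z : Q, ρ (SemidirectProduct.inr z) (∑ x : P, ρ (SemidirectProduct.inl x) τ) =
      ∑ x : P, ρ (SemidirectProduct.inl x) τ := by
    intro z
    conv_rhs => rw [← Equiv.sum_comp (φ z).toEquiv]
    rw [map_sum]
    refine Finset.sum_congr rfl fun x _ => ?_
    conv_rhs => rw [← hτ z, hmul]
    rw [hmul]
    congr 2
    change _ = SemidirectProduct.inl (φ z x) * SemidirectProduct.inr z
    rw [SemidirectProduct.inl_aut, map_inv, inv_mul_cancel_right]
  have hinl : ∀ y : P, ρ (SemidirectProduct.inl y) (∑ x : P, ρ (SemidirectProduct.inl x) τ) =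
      ∑ x : P, ρ (SemidirectProduct.inl x) τ := by
    intro y
    conv_rhs => rw [← Equiv.sum_comp (Equiv.mulLeft y)]
    rw [map_sum]
    exact Finset.sum_congr rfl fun x _ => by
      rw [hmul, ← map_mul SemidirectProduct.inl, Equiv.coe_mulLeft]
  conv_lhs => rw [← SemidirectProduct.inl_left_mul_inr_right g, ← hmul, hinr, hinl]

/-! ### Linear characters of `q`-groups -/

section Characters

variable {q : ℕ} {S : Type*} [Group S]

/-- A proper subgroup of a finite `q`-group is in the kernel of a nontrivial character of
order `q`. -/
theorem exists_character_ne_one [Fact q.Prime] [Finite S] (hS : IsPGroup q S) {C : Subgroup S} (hC : C ≠ ⊤) :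
    ∃ χ : S →* rootsOfUnity q ℂ, C ≤ χ.ker ∧ χ ≠ 1 := by
  obtain ⟨M, hM, hCM⟩ := (eq_top_or_exists_le_coatom C).resolve_left hC
  have := hS.isNilpotent
  have hn : M.Normal :=
    NormalizerCondition.normal_of_coatom M Group.normalizerCondition_of_isNilpotent hM
  have hnt : Nontrivial (S ⧸ M) := QuotientGroup.nontrivial_iff.2 hM.1
  obtain ⟨n, hn0, hn⟩ := (hS.to_quotient M).nontrivial_iff_card.1 hnt
  obtain ⟨x, hx⟩ := exists_prime_orderOf_dvd_card' (G := S ⧸ M) q (hn ▸ dvd_pow_self q hn0.ne')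
  -- The preimage of a subgroup of order `q` strictly contains the maximal subgroup `M`, so `S ⧸ M`
  -- has order `q`.
  have htop : (zpowers x).comap (QuotientGroup.mk' M) = ⊤ := by
    refine hM.2 _ (lt_of_le_of_ne (fun m hm => ?_) fun heq => ?_)
    · rw [mem_comap, QuotientGroup.mk'_apply, (QuotientGroup.eq_one_iff m).2 hm]
      exact one_mem _
    · induction x using QuotientGroup.induction_on with | H s => ?_
      have hs : s ∈ M := by
        rw [heq, mem_comap]
        exact mem_zpowers _
      rw [(QuotientGroup.eq_one_iff s).2 hs, orderOf_one] at hx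
      exact (Fact.out : q.Prime).ne_one hx.symm
  have hz : zpowers x = ⊤ := by
    rw [eq_top_iff]
    intro y _
    induction y using QuotientGroup.induction_on with | H s => ?_
    exact mem_comap.1 (htop ▸ mem_top s : s ∈ (zpowers x).comap (QuotientGroup.mk' M))
  have hcard : Nat.card (S ⧸ M) = q := by
    rw [← hx, ← Nat.card_zpowers, hz, Subgroup.card_top]
  let i := mulEquivOfPrimeCardEq hcard (Complex.card_rootsOfUnity q)
  refine ⟨i.toMonoidHom.comp (QuotientGroup.mk' M), fun c hc => ?_, fun h => ?_⟩
  · rw [MonoidHom.mem_ker, MonoidHom.comp_apply, QuotientGroup.mk'_apply,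
      (QuotientGroup.eq_one_iff c).2 (hCM hc), map_one]
  · obtain ⟨y, hy⟩ := exists_ne (1 : S ⧸ M)
    induction y using QuotientGroup.induction_on with | H s => ?_
    refine hy (i.injective ?_)
    rw [map_one]
    exact DFunLike.congr_fun h s

/-- The kernel is everything or has prime index `q`, and in the latter case it is maximal. -/
theorem frattini_le_ker_of_rootsOfUnity [Fact q.Prime] (χ : S →* rootsOfUnity q ℂ) : frattini S ≤ χ.ker := by
  by_cases h : χ.ker = ⊤
  · rw [h]; exact le_top
  refine frattini_le_coatom ⟨h, fun K hK => ?_⟩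
  have hidx : χ.ker.index = q := by
    have hdvd : χ.ker.index ∣ q := by
      rw [index_ker]
      exact (Subgroup.card_subgroup_dvd_card χ.range).trans
        (dvd_of_eq (Complex.card_rootsOfUnity q))
    exact ((Nat.dvd_prime Fact.out).1 hdvd).resolve_left fun h1 => h (index_eq_one.1 h1)
  have hmul := relIndex_mul_index hK.le
  rw [hidx] at hmul
  rcases (Nat.dvd_prime (Fact.out : q.Prime)).1 (Dvd.intro_left _ hmul) with h1 | h1
  · exact index_eq_one.1 h1
  · exfalso
    rw [h1] at hmul
    have h2 : χ.ker.relIndex K = 1 :=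
      Nat.eq_of_mul_eq_mul_right (Fact.out : q.Prime).pos (by rw [hmul, one_mul])
    exact hK.not_ge (relIndex_eq_one.1 h2)

/-- An automorphism of `p`-power order of a finite `q`-group that fixes all characters of order `q` is
trivial. -/
theorem eq_one_of_fixes_characters [Fact q.Prime] [Finite S] {p : ℕ} [Fact p.Prime] (hpq : p ≠ q)
    (hS : IsPGroup q S) {σ : MulAut S} (hσ : IsPGroup p (zpowers σ))
    (h : ∀ (χ : S →* rootsOfUnity q ℂ) (s : S), χ (σ s) = χ s) : σ = 1 := by
  let C : Subgroup S :=
    { carrier := {s | σ s = s}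
      one_mem' := map_one σ
      mul_mem' := fun {a b} ha hb => by
        change σ (a * b) = a * b
        rw [map_mul, show σ a = a from ha, show σ b = b from hb]
      inv_mem' := fun {a} ha => by
        change σ a⁻¹ = a⁻¹
        rw [map_inv, show σ a = a from ha] }
  by_cases hC : C = ⊤
  · ext s
    exact (hC ▸ mem_top s : s ∈ C)
  exfalso
  obtain ⟨χ, hCχ, hχ⟩ := exists_character_ne_one hS hC
  obtain ⟨s, hs⟩ : ∃ s, χ s ≠ 1 := by
    by_contra! hcon
    exact hχ (MonoidHom.ext hcon)
  have hfib : ∀ τ ∈ zpowers σ, ∀ x, χ (τ x) = χ x := by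
    let F : Subgroup (MulAut S) :=
      { carrier := {τ | ∀ x, χ (τ x) = χ x}
        one_mem' := fun x => rfl
        mul_mem' := fun {a b} ha hb x => by rw [MulAut.mul_apply, ha, hb]
        inv_mem' := fun {a} ha x => by rw [← ha (a⁻¹ x), MulAut.apply_inv_self] }
    have hle : zpowers σ ≤ F := zpowers_le.2 fun x => h χ x
    exact fun τ hτ => hle hτ
  -- The fibre of `χ` through `s` has as many elements as the kernel, a number prime to `p`, so `σ`
  -- fixes a point of it. That point lies in `C ≤ χ.ker`, against `χ s ≠ 1`.
  let _ : MulAction (zpowers σ) {x : S // χ x = χ s} :=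
    { smul := fun τ x => ⟨(τ : MulAut S) x, by rw [hfib τ τ.2, x.2]⟩
      one_smul := fun x => rfl
      mul_smul := fun a b x => rfl }
  have hcard : Nat.card {x : S // χ x = χ s} = Nat.card χ.ker :=
    Nat.card_congr
      { toFun := fun x => ⟨s⁻¹ * x, by rw [MonoidHom.mem_ker, map_mul, x.2, map_inv, inv_mul_cancel]⟩
        invFun := fun k => ⟨s * k, by rw [map_mul, MonoidHom.mem_ker.1 k.2, mul_one]⟩
        left_inv := fun x => Subtype.ext (mul_inv_cancel_left _ _)
        right_inv := fun k => Subtype.ext (inv_mul_cancel_left _ _) }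
  have hndvd : ¬ p ∣ Nat.card {x : S // χ x = χ s} := by
    rw [hcard]
    intro hdvd
    have hcop := coprime_card_of_isPGroup hpq.symm (hS.to_subgroup χ.ker)
    exact (Fact.out : p.Prime).ne_one (Nat.eq_one_of_dvd_coprimes hcop hdvd dvd_rfl)
  obtain ⟨x, hx⟩ := hσ.nonempty_fixed_point_of_prime_not_dvd_card _ hndvd
  have hxC : (x : S) ∈ C := congrArg Subtype.val (hx ⟨σ, mem_zpowers σ⟩)
  exact hs (by rw [← x.2]; exact MonoidHom.mem_ker.1 (hCχ hxC))

/-- The action on the characters of order `q` induced by an action on `S`. -/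
def characterAction (q : ℕ) {G : Type*} [Group G] (α : G →* MulAut S) :
    G →* AddMonoid.End (Additive (S →* rootsOfUnity q ℂ)) where
  toFun g :=
    { toFun := fun χ => Additive.ofMul (χ.toMul.comp (α g⁻¹).toMonoidHom)
      map_zero' := rfl
      map_add' := fun _ _ => rfl }
  map_one' := AddMonoidHom.ext fun χ => MonoidHom.ext
    (f := χ.toMul.comp (α 1⁻¹).toMonoidHom) (g := χ.toMul) fun s => by simp
  map_mul' g h := AddMonoidHom.ext fun χ => MonoidHom.ext
    (f := χ.toMul.comp (α (g * h)⁻¹).toMonoidHom)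
    (g := (χ.toMul.comp (α h⁻¹).toMonoidHom).comp (α g⁻¹).toMonoidHom) fun s => by simp

theorem characterAction_apply {G : Type*} [Group G] (α : G →* MulAut S) (g : G)
    (χ : Additive (S →* rootsOfUnity q ℂ)) (s : S) :
    (characterAction q α g χ).toMul s = χ.toMul (α g⁻¹ s) := rfl

/-- The complex linear character underlying a character of order `q`. -/
def toLinChar (χ : S →* rootsOfUnity q ℂ) : S →* ℂˣ := (rootsOfUnity q ℂ).subtype.comp χ

theorem ker_toLinChar (χ : S →* rootsOfUnity q ℂ) : (toLinChar χ).ker = χ.ker := by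
  ext s
  simp [toLinChar, MonoidHom.mem_ker]

theorem mem_linCharStabilizer_toLinChar {G : Type*} [Group G] (α : G →* MulAut S)
    (χ : Additive (S →* rootsOfUnity q ℂ)) (g : G) :
    g ∈ linCharStabilizer α (toLinChar χ.toMul) ↔ characterAction q α g χ = χ := by
  have h1 : g ∈ linCharStabilizer α (toLinChar χ.toMul) ↔
      ∀ s, χ.toMul (α g s) = χ.toMul s :=
    forall_congr' fun s => Subtype.val_injective.eq_iff
  rw [h1]
  constructor
  · intro h
    refine MonoidHom.ext (f := (characterAction q α g χ).toMul) (g := χ.toMul) fun s => ?_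
    rw [characterAction_apply, ← h (α g⁻¹ s), ← MulAut.mul_apply, ← map_mul, mul_inv_cancel,
      map_one, MulAut.one_apply]
  · intro h s
    conv_lhs => rw [← h, characterAction_apply, ← MulAut.mul_apply, ← map_mul, inv_mul_cancel,
      map_one, MulAut.one_apply]

end Characters

end CoprimeAction

/-! ### Assembly of the three statements -/

open CoprimeAction in
theorem mainTheorem5 (p q : ℕ) [Fact p.Prime] [Fact q.Prime] (hp : Odd p) (hq : Odd q)
    (hpq : p ≠ q) (P Q : Type*) [Group P] [Group Q] [Finite P] [Finite Q]
    (hP : IsPGroup p P) (hQ : IsPGroup q Q) (φ : Q →* MulAut P) :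
    (∀ (T : Type*) [AddCommGroup T] [Module (ZMod q) T] [FiniteDimensional (ZMod q) T]
        (ρ : Representation (ZMod q) (P ⋊[φ] Q) T),
        Function.Injective (ρ.comp (SemidirectProduct.inl : P →* P ⋊[φ] Q)) →
        ∃ τ : T, CoprimeAction.vectorStabilizer ρ τ =
          (SemidirectProduct.inr : Q →* P ⋊[φ] Q).range) ∧
    (∀ (S : Type*) [Group S] [Finite S], IsPGroup q S →
        ∀ α : (P ⋊[φ] Q) →* MulAut S,
        Function.Injective (α.comp (SemidirectProduct.inl : P →* P ⋊[φ] Q)) →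
        (∃ χ : S →* ℂˣ, frattini S ≤ χ.ker ∧
          CoprimeAction.linCharStabilizer α χ =
            (SemidirectProduct.inr : Q →* P ⋊[φ] Q).range) ∧
        (∃ χ : S →* ℂˣ,
          CoprimeAction.actionCentralizer
            (α.comp (SemidirectProduct.inl : P →* P ⋊[φ] Q)) ≤ χ.ker ∧
          CoprimeAction.linCharStabilizer α χ =
            (SemidirectProduct.inr : Q →* P ⋊[φ] Q).range)) := by
  refine ⟨fun T _ _ _ ρ hρ => ?_, fun S _ _ hS α hα => ?_⟩
  · have : Finite T := Module.finite_of_finite (ZMod q)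
    have hT : ∀ t : T, q • t = 0 := fun t => by
      rw [← Nat.cast_smul_eq_nsmul (ZMod q), CharP.cast_eq_zero, zero_smul]
    let ρ' : P ⋊[φ] Q →* AddMonoid.End T :=
      { toFun := fun g => (ρ g).toAddMonoidHom
        map_one' := by rw [map_one]; rfl
        map_mul' := fun g h => by rw [map_mul]; rfl }
    obtain ⟨τ, hτ⟩ := exists_stabilizer_eq_range_inr hp hq hpq hP hQ hT ρ' (fun x y hxy => hρ <|
      LinearMap.ext fun t => DFunLike.congr_fun hxy t)
    exact ⟨τ, Subgroup.ext hτ⟩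
  have hfin : Finite (S →* rootsOfUnity q ℂ) := DFunLike.finite _
  have : Finite (Additive (S →* rootsOfUnity q ℂ)) := hfin
  have hT : ∀ χ : Additive (S →* rootsOfUnity q ℂ), q • χ = 0 := fun χ =>
    MonoidHom.ext (f := χ.toMul ^ q) (g := 1) fun s => Subtype.ext (χ.toMul s).2
  obtain ⟨τ, hτ⟩ := exists_stabilizer_eq_range_inr hp hq hpq hP hQ hT (characterAction q α) (by
    rw [injective_iff_map_eq_one]
    intro x hx
    refine hα ?_
    rw [map_one]
    refine eq_one_of_fixes_characters hpq hS ?_ fun χ s => ?_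
    · have : Subgroup.zpowers ((α.comp SemidirectProduct.inl) x) =
          (Subgroup.zpowers x).map (α.comp SemidirectProduct.inl) := by
        rw [MonoidHom.map_zpowers]
      rw [this]
      exact (hP.to_subgroup _).map _
    · exact Subtype.ext ((mem_linCharStabilizer_toLinChar α (Additive.ofMul χ) _).2
        (DFunLike.congr_fun hx (Additive.ofMul χ)) s))
  refine ⟨⟨toLinChar τ.toMul, ?_, ?_⟩, ?_⟩
  · rw [ker_toLinChar]
    exact frattini_le_ker_of_rootsOfUnity _
  · ext g
    rw [mem_linCharStabilizer_toLinChar, hτ]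
  let _ := Fintype.ofFinite P
  -- `c` inverts the order of `P` modulo `q`, so `c • a` is the average of `τ` over `P`.
  obtain ⟨c, hc⟩ := exists_nsmul_inverse (Fact.out : q.Prime).one_lt hT
    (coprime_card_of_isPGroup hpq hP)
  set a := ∑ x : P, characterAction q α (SemidirectProduct.inl x) τ with ha
  have hfix : ∀ g, characterAction q α g a = a :=
    map_sum_inl_eq _ fun g => (hτ _).2 ⟨g, rfl⟩
  -- At an element centralized by `P` all translates of `τ` agree with `τ`, so `τ` and its average
  -- cancel. The average is fixed by the whole semidirect product, so the stabilizer stays that of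
  -- `τ`.
  refine ⟨toLinChar (τ - c • a).toMul, fun s hs => ?_, ?_⟩
  · rw [ker_toLinChar, MonoidHom.mem_ker]
    let ev : Additive (S →* rootsOfUnity q ℂ) →+ Additive (rootsOfUnity q ℂ) :=
      (MonoidHom.eval s).toAdditive
    have hev : ∀ x : P, ev (characterAction q α (SemidirectProduct.inl x) τ) = ev τ := fun x => by
      change τ.toMul (α (SemidirectProduct.inl x)⁻¹ s) = τ.toMul s
      rw [← map_inv]
      exact congrArg _ (hs x⁻¹)
    have hsum : ev (τ - c • a) = 0 := by
      rw [map_sub, map_nsmul, ha, map_sum, Finset.sum_congr rfl fun x _ => hev x,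
        Finset.sum_const, Finset.card_univ, ← Nat.card_eq_fintype_card, ← mul_smul, ← map_nsmul, hc,
        sub_self]
    exact hsum
  · ext g
    rw [mem_linCharStabilizer_toLinChar, ← hτ, map_sub, map_nsmul, hfix, sub_left_inj]
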